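/- Let $n\ge 1$, $d=2^n$, let $O$ be a Hermitian $d\times d$ matrix, $\lambda_1,\dots,\lambda_d\in\mathbb R$ and $S(x)=\mathrm{diag}(e^{-ix\lambda_1},\dots,e^{-ix\lambda_d})$. Let $W^1(\theta),W^2(\theta)$ be independent random unitaries in $U(d)$, and consider the single-layer model $$f(x,\theta)=\langle 0|U(x,\theta)^\dagger O\,U(x,\theta)|0\rangle,\qquad U(x,\theta)=W^2(\theta)S(x)W^1(\theta).$$ Let $\Omega=\{\lambda_j-\lambda_{j'}\}$, $R(\omega)=\{(j,j'):\lambda_j-\lambda_{j'}=\omega\}$, and let $$c_\omega=\sum_{(j,j')\in R(\omega)}\langle 0|W^{1\dagger}|j\rangle\langle j|W^{2\dagger}OW^2|j'\rangle\langle j'|W^1|0\rangle,$$ so that $f(x,\theta)=\sum_{\omega\in\Omega}c_\omega(\theta)e^{i\omega x}$. For $l\in\{1,2\}$ let $$\mathcal A_l=\mathbb E_{W\sim\mathrm{Haar}}[W^{\otimes2}\otimes (W^*)^{\otimes2}]-\mathbb E_\theta[W^l(\theta)^{\otimes2}\otimes (W^l(\theta)^*)^{\otimes2}],$$ where $W^*$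 is the entrywise complex conjugate; $\mathcal A_l$ is a $d^4\times d^4$ matrix, which is also the superoperator $X\mapsto \mathbb E_{\mathrm{Haar}}[W^{\otimes 2}XW^{\dagger\otimes 2}]-\mathbb E_\theta[W^l(\theta)^{\otimes 2}XW^l(\theta)^{\dagger\otimes 2}]$. Let $\mathrm{Var}[X]=\mathbb E|X-\mathbb EX|^2$, and let $\mathrm{Var}_{\text{2-design}}[c_\omega]$ be the variance of $c_\omega$ when $W^1,W^2$ are independent and Haar distributed. Write $\|\cdot\|_p$ for the Schatten $p$-norms, and put $$C_1=\frac{d\|O\|_2^2-\mathrm{Tr}(O)^2}{d(d^2-1)},\qquad C_2=\frac1{d^2}\sum_{k,l}\big|[O^{\otimes2}]_{k,l}\big|.$$ Then for every $\omega\in\Omega$ $$\mathrm{Var}_{\text{2-design}}[c_\omega]=\frac{C_1}{d(d+1)}\big(|R(\omega)|-\delta_{\omega,0}\big),$$ and for every $\varepsilon\ge 0$: 1. (diamond norm) if $\sup_k\sup_{X\ne0}\|(\mathcal A_l\otimes\mathrm{id}_k)(X)\|_1/\|X\|_1\le\varepsilon$ for $l=1,2$, then $$\mathrm{Var}[c_\omega]\le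 \mathrm{Var}_{\text{2-design}}[c_\omega]+C_1\varepsilon+\|O\|_1^2\varepsilon^2+\frac{\|O\|_\infty^2}{d(d+1)}|R(\omega)|\,\varepsilon;$$ 2. (monomial distance) if $d^2\max_{a,b}|(\mathcal A_l)_{a,b}|\le\varepsilon$ for $l=1,2$, then $$\mathrm{Var}[c_\omega]\le \mathrm{Var}_{\text{2-design}}[c_\omega]+\Big(\frac{C_1}{d^2}+\frac{C_2}{d(d+1)}\Big)\varepsilon|R(\omega)|+\frac{C_2}{d^2}\big(\varepsilon|R(\omega)|\big)^2;$$ 3. (spectral norm) if the largest singular value of the matrix $\mathcal A_l$ is at most $\varepsilon$ for $l=1,2$, then $$\mathrm{Var}[c_\omega]\le \mathrm{Var}_{\text{2-design}}[c_\omega]+\Big(C_1+\frac{\|O\|_2^2}{d(d+1)}\Big)\varepsilon\sqrt{|R(\omega)|}+\|O\|_2^2\,\varepsilon^2|R(\omega)|.$$ -/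

import Mathlib

open MeasureTheory ProbabilityTheory
open scoped Kronecker ENNReal

namespace FourierModel

/-- The unitary group `U(d)`. -/
abbrev U (d : ℕ) : Type := Matrix.unitaryGroup (Fin d) ℂ

/-- Borel σ-algebra on `U(d)`, for the topology induced by the entries. -/
noncomputable instance instMeasurableSpaceU (d : ℕ) : MeasurableSpace (U d) := borel (U d)

instance instBorelSpaceU (d : ℕ) : BorelSpace (U d) := ⟨rfl⟩

noncomputable instance instCompactSpaceU (d : ℕ) : CompactSpace (U d) := by
  have hcl : IsClosed ((unitary (Matrix (Fin d) (Fin d) ℂ) : Set (Matrix (Fin d) (Fin d) ℂ))) :=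
    isClosed_unitary
  have hK : IsCompact (Set.pi Set.univ (fun _ : Fin d => Set.pi Set.univ
      (fun _ : Fin d => Metric.closedBall (0 : ℂ) 1))) :=
    isCompact_univ_pi fun _ => isCompact_univ_pi fun _ => isCompact_closedBall _ _
  refine isCompact_iff_compactSpace.mp (hK.of_isClosed_subset hcl ?_)
  intro W hW i _ j _
  simpa using entry_norm_bound_of_unitary (𝕜 := ℂ) hW i j

/-- The Haar probability measure on `U(d)`. -/
noncomputable def haarU (d : ℕ) : Measure (U d) := Measure.haarMeasure ⊤

/-! ### The single-layer model -/

/-- The encoding unitary `S(x) = exp(-i x H)` of the diagonal Hamiltonian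
`H = diag(lam 0, …, lam (d-1))`. -/
noncomputable def encoding {d : ℕ} (lam : Fin d → ℝ) (x : ℝ) : Matrix (Fin d) (Fin d) ℂ :=
  Matrix.diagonal fun j => Complex.exp (-(Complex.I * x * lam j))

/-- The circuit `W₂ S(x) W₁`. -/
noncomputable def circuit {d : ℕ} (lam : Fin d → ℝ) (W₁ W₂ : U d) (x : ℝ) :
    Matrix (Fin d) (Fin d) ℂ :=
  (W₂ : Matrix (Fin d) (Fin d) ℂ) * encoding lam x * (W₁ : Matrix (Fin d) (Fin d) ℂ)

/-- The model `f(x) = ⟨0| U(x)† O U(x) |0⟩` with `U(x) = W₂ S(x) W₁`. -/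
noncomputable def model {d : ℕ} [NeZero d] (lam : Fin d → ℝ) (O : Matrix (Fin d) (Fin d) ℂ)
    (W₁ W₂ : U d) (x : ℝ) : ℂ :=
  ((circuit lam W₁ W₂ x).conjTranspose * O * circuit lam W₁ W₂ x) 0 0

/-- The spectrum: the set of distinct differences of eigenvalues. -/
noncomputable def spectrum {d : ℕ} (lam : Fin d → ℝ) : Finset ℝ :=
  Finset.univ.image fun p : Fin d × Fin d => lam p.1 - lam p.2

/-- The frequency generator `R(ω)`; its cardinality is the redundancy of `ω`. -/
noncomputable def generator {d : ℕ} (lam : Fin d → ℝ) (ω : ℝ) : Finset (Fin d × Fin d) :=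
  Finset.univ.filter fun p => lam p.1 - lam p.2 = ω

/-- The Fourier coefficient
`c_ω = ∑_{(j, j') ∈ R(ω)} ⟨0| W₁† |j⟩⟨j| W₂† O W₂ |j'⟩⟨j'| W₁ |0⟩`. -/
noncomputable def fourierCoeff {d : ℕ} [NeZero d] (lam : Fin d → ℝ)
    (O : Matrix (Fin d) (Fin d) ℂ) (ω : ℝ) (W₁ W₂ : U d) : ℂ :=
  ∑ p ∈ generator lam ω,
    star ((W₁ : Matrix (Fin d) (Fin d) ℂ) p.1 0) *
      ((W₂ : Matrix (Fin d) (Fin d) ℂ).conjTranspose * O *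
        (W₂ : Matrix (Fin d) (Fin d) ℂ)) p.1 p.2 *
      (W₁ : Matrix (Fin d) (Fin d) ℂ) p.2 0

/-- The `fourierCoeff`s are the coefficients of the Fourier decomposition of the model. -/
theorem model_eq_sum_fourierCoeff {d : ℕ} [NeZero d] (lam : Fin d → ℝ)
    (O : Matrix (Fin d) (Fin d) ℂ) (W₁ W₂ : U d) (x : ℝ) :
    model lam O W₁ W₂ x =
      ∑ ω ∈ spectrum lam, fourierCoeff lam O ω W₁ W₂ * Complex.exp (Complex.I * ω * x) := by
  have hR : ∀ ω ∈ spectrum lam,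
      fourierCoeff lam O ω W₁ W₂ * Complex.exp (Complex.I * ω * x) =
      ∑ p ∈ Finset.univ.filter (fun p : Fin d × Fin d => lam p.1 - lam p.2 = ω),
        star ((W₁ : Matrix (Fin d) (Fin d) ℂ) p.1 0) *
          ((W₂ : Matrix (Fin d) (Fin d) ℂ).conjTranspose * O *
            (W₂ : Matrix (Fin d) (Fin d) ℂ)) p.1 p.2 *
          (W₁ : Matrix (Fin d) (Fin d) ℂ) p.2 0 *
          Complex.exp (Complex.I * (lam p.1 - lam p.2) * x) := by
    intro ω _
    unfold fourierCoeff generator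
    rw [Finset.sum_mul]
    refine Finset.sum_congr rfl fun p hp => ?_
    rw [← (Finset.mem_filter.mp hp).2]
    push_cast
    rfl
  rw [Finset.sum_congr rfl hR, Finset.sum_fiberwise_of_maps_to
    (g := fun p : Fin d × Fin d => lam p.1 - lam p.2) (t := spectrum lam)
    (fun p _ => Finset.mem_image_of_mem _ (Finset.mem_univ p))]
  have hM : model lam O W₁ W₂ x =
      ((W₁ : Matrix (Fin d) (Fin d) ℂ).conjTranspose * ((encoding lam x).conjTranspose *
        ((W₂ : Matrix (Fin d) (Fin d) ℂ).conjTranspose * O *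
          (W₂ : Matrix (Fin d) (Fin d) ℂ)) * encoding lam x) *
          (W₁ : Matrix (Fin d) (Fin d) ℂ)) 0 0 := by
    simp only [model, circuit, Matrix.conjTranspose_mul, Matrix.mul_assoc]
  rw [hM]
  generalize (W₂ : Matrix (Fin d) (Fin d) ℂ).conjTranspose * O *
    (W₂ : Matrix (Fin d) (Fin d) ℂ) = T
  rw [Matrix.mul_apply, Fintype.sum_prod_type_right]
  refine Finset.sum_congr rfl fun j _ => ?_
  rw [Matrix.mul_apply, Finset.sum_mul]
  refine Finset.sum_congr rfl fun i _ => ?_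
  simp only [encoding, Matrix.diagonal_conjTranspose, Matrix.mul_diagonal, Matrix.diagonal_mul,
    Matrix.conjTranspose_apply, Pi.star_apply]
  have he : Complex.exp (Complex.I * (lam i - lam j) * x) =
      star (Complex.exp (-(Complex.I * x * lam i))) * Complex.exp (-(Complex.I * x * lam j)) := by
    rw [Complex.star_def, ← Complex.exp_conj, ← Complex.exp_add]
    congr 1
    simp
    ring
  rw [he]
  ring

/-! ### Variance and distance to a 2-design -/

/-- The variance `E |X - E X|²` of a complex random variable. -/
noncomputable def cvar {Ω : Type*} [MeasurableSpace Ω] (P : Measure Ω) (X : Ω → ℂ) : ℝ :=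
  ∫ θ, ‖X θ - ∫ θ', X θ' ∂P‖ ^ 2 ∂P

/-- The variance of `c_ω` under the 2-design assumption: `W₁`, `W₂` independent and
Haar distributed. -/
noncomputable def varTwoDesign {d : ℕ} [NeZero d] (lam : Fin d → ℝ)
    (O : Matrix (Fin d) (Fin d) ℂ) (ω : ℝ) : ℝ :=
  cvar ((haarU d).prod (haarU d)) fun W => fourierCoeff lam O ω W.1 W.2

/-- The index set of the computational basis of `ℂ^d ⊗ ℂ^d`. -/
abbrev Idx (d : ℕ) : Type := Fin d × Fin d

/-- `W ⊗ W ⊗ W* ⊗ W*`, where `W*` is the entrywise complex conjugate. -/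
noncomputable def momentMatrix {d : ℕ} (W : U d) : Matrix (Idx d × Idx d) (Idx d × Idx d) ℂ :=
  ((W : Matrix (Fin d) (Fin d) ℂ) ⊗ₖ (W : Matrix (Fin d) (Fin d) ℂ)) ⊗ₖ
    (((W : Matrix (Fin d) (Fin d) ℂ).map star) ⊗ₖ ((W : Matrix (Fin d) (Fin d) ℂ).map star))

/-- The second-moment superoperator `E[W ⊗ W ⊗ W* ⊗ W*]` of a random unitary `W`. -/
noncomputable def secondMoment {d : ℕ} {Ω : Type*} [MeasurableSpace Ω] (P : Measure Ω)
    (W : Ω → U d) : Matrix (Idx d × Idx d) (Idx d × Idx d) ℂ :=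
  Matrix.of fun a b => ∫ θ, momentMatrix (W θ) a b ∂P

/-- The superoperator `A = M_Haar - M_W` measuring the deviation from a 2-design. -/
noncomputable def deviation {d : ℕ} {Ω : Type*} [MeasurableSpace Ω] (P : Measure Ω)
    (W : Ω → U d) : Matrix (Idx d × Idx d) (Idx d × Idx d) ℂ :=
  secondMoment (haarU d) id - secondMoment P W

/-- The action `S ⊗ id_k` of a superoperator matrix `S`, acting on operators through
`(S X)_{i j} = ∑_{k, l} S_{(i, j), (k, l)} X_{k l}`, with an ancilla of dimension `k`.
For `S = A ⊗ B*` the action is `X ↦ A X B†`. -/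
noncomputable def ampliate {ι : Type*} [Fintype ι] (S : Matrix (ι × ι) (ι × ι) ℂ) (k : ℕ)
    (X : Matrix (ι × Fin k) (ι × Fin k) ℂ) : Matrix (ι × Fin k) (ι × Fin k) ℂ :=
  Matrix.of fun a b => ∑ p : ι × ι, S (a.1, b.1) p * X (p.1, a.2) (p.2, b.2)

/-- Schatten `p`-norm `(∑ σᵢ ^ p) ^ (1 / p)`, `1 ≤ p < ∞`, where the singular values `σᵢ` are the
square roots of the eigenvalues of `A† A`. -/
noncomputable def schattenNorm {ι : Type*} [Fintype ι] [DecidableEq ι] (p : ℝ)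
    (A : Matrix ι ι ℂ) : ℝ :=
  (∑ i, (√((Matrix.isHermitian_conjTranspose_mul_self A).eigenvalues i)) ^ p) ^ (1 / p)

/-- The spectral norm (Schatten `∞`-norm): the operator norm on Euclidean space. -/
noncomputable def spectralNorm {ι : Type*} [Fintype ι] [DecidableEq ι] (A : Matrix ι ι ℂ) : ℝ :=
  ‖Matrix.toEuclideanCLM (n := ι) (𝕜 := ℂ) A‖

/-- The diamond norm `sup_k sup_{X ≠ 0} ‖(S ⊗ id_k)(X)‖₁ / ‖X‖₁`. -/
noncomputable def diamondNorm {ι : Type*} [Fintype ι] [DecidableEq ι]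
    (S : Matrix (ι × ι) (ι × ι) ℂ) : ℝ≥0∞ :=
  ⨆ (k : ℕ) (X : Matrix (ι × Fin k) (ι × Fin k) ℂ) (_ : X ≠ 0),
    ENNReal.ofReal (schattenNorm 1 (ampliate S k X) / schattenNorm 1 X)

/-- `W` is an `ε`-approximate 2-design in diamond norm. -/
def IsApproxTwoDesignDiamond {d : ℕ} {Ω : Type*} [MeasurableSpace Ω] (P : Measure Ω)
    (W : Ω → U d) (ε : ℝ) : Prop :=
  diamondNorm (deviation P W) ≤ ENNReal.ofReal ε

/-- `W` is an `ε`-approximate 2-design in spectral norm. -/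
def IsApproxTwoDesignSpectral {d : ℕ} {Ω : Type*} [MeasurableSpace Ω] (P : Measure Ω)
    (W : Ω → U d) (ε : ℝ) : Prop :=
  spectralNorm (deviation P W) ≤ ε

/-- `W` is a monomial `ε`-approximate 2-design: `max_{a, b} |A_{a b}| ≤ ε / d²`. -/
def IsApproxTwoDesignMonomial {d : ℕ} {Ω : Type*} [MeasurableSpace Ω] (P : Measure Ω)
    (W : Ω → U d) (ε : ℝ) : Prop :=
  ∀ a b, ‖deviation P W a b‖ ≤ ε / (d : ℝ) ^ 2

/-- `C₁ = (d ‖O‖₂² - Tr(O)²) / (d (d² - 1))`. -/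
noncomputable def C₁ {d : ℕ} (O : Matrix (Fin d) (Fin d) ℂ) : ℝ :=
  (d * schattenNorm 2 O ^ 2 - O.trace.re ^ 2) / (d * ((d : ℝ) ^ 2 - 1))

/-- `C₂ = ∑_{k, l} |(O ⊗ O)_{k l}| / d²`. -/
noncomputable def C₂ {d : ℕ} (O : Matrix (Fin d) (Fin d) ℂ) : ℝ :=
  ∑ k, ∑ l, ‖(O ⊗ₖ O) k l‖ / (d : ℝ) ^ 2

end FourierModel

namespace FourierModel

/-! Subtracting `(Tr O / d) • 1` from `O` changes only `c_0`, and only by a constant, so the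
variance may be computed with the traceless part of `O` (`cvar_fourierCoeff_centered`). For a
Hermitian observable, `|c_ω|²` is a sum over pairs `p, q ∈ R(ω)` of a monomial in the first column
of `W¹` times a product of two entries of `W²† O W²`. By independence `E|c_ω|²` is then bilinear in
the two second-moment matrices; this is `coeffMoment`.

Writing each second moment as Haar minus deviation gives four terms. The Haar moments come from the
commutant of `g ⊗ g`, spanned by the identity and the swap (`exists_eq_of_commute_kronecker`): each
is a combination of `δ_{p,q}` and the indicator `D` that both `p` and `q` are diagonal. The
Haar-Haar term is therefore a count over `R(ω)`. It equals the 2-design variance, because the Haar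
mean of `c_ω` vanishes for a traceless observable. For a general ensemble the squared mean enters
with a minus sign and can be dropped.

In the two mixed terms the `D` part disappears: it tests the deviation against a trace, which is the
same for every unitary (`linear_deviation_eq_zero`). What remains is `C₁` times a diagonal sum of
state moments, and a diagonal sum of observable moments over `d(d+1)`. The same principle restores
the original `O` in the latter. This is `cvar_fourierCoeff_le`.

The three claims bound these two sums and the deviation-deviation term. Entrywise bounds are summed
over `R(ω)`. A spectral bound controls a column of the deviation and the image of `O ⊗ O` under its
transpose in Euclidean norm, and Cauchy-Schwarz over `R(ω)` gives `√|R(ω)|`. A diamond bound is used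
through the duality of trace and operator norm; restricting to `R(ω)` amounts to keeping matching
blocks of an operator, which does not increase its norm. -/

/-! ### Euclidean norms and bilinear bounds -/

/-- The Euclidean norm of a complex vector. -/
noncomputable def l2norm {ι : Type*} [Fintype ι] (x : ι → ℂ) : ℝ := √(∑ i, ‖x i‖ ^ 2)

/-- The bilinear form of `B` is bounded by `c` in the Euclidean norms. -/
def BilinBound {ι κ : Type*} [Fintype ι] [Fintype κ] (B : Matrix ι κ ℂ) (c : ℝ) : Prop :=
  ∀ (y : ι → ℂ) (x : κ → ℂ), ‖∑ i, ∑ j, y i * B i j * x j‖ ≤ c * l2norm x * l2norm y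

section LinearAlgebra

variable {ι κ τ υ : Type*} [Fintype ι] [Fintype κ] [Fintype τ] [Fintype υ]

lemma l2norm_nonneg (x : ι → ℂ) : 0 ≤ l2norm x := Real.sqrt_nonneg _

lemma l2norm_sq (x : ι → ℂ) : l2norm x ^ 2 = ∑ i, ‖x i‖ ^ 2 :=
  Real.sq_sqrt (Finset.sum_nonneg fun _ _ => sq_nonneg _)

lemma l2norm_star (x : ι → ℂ) : l2norm (fun i => star (x i)) = l2norm x := by
  simp [l2norm]

lemma l2norm_pos {x : ι → ℂ} {i : ι} (h : x i ≠ 0) : 0 < l2norm x := by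
  refine Real.sqrt_pos.2 (Finset.sum_pos' (fun _ _ => sq_nonneg _) ⟨i, Finset.mem_univ _, ?_⟩)
  have := norm_pos_iff.2 h
  positivity

lemma l2norm_eq_norm (x : EuclideanSpace ℂ ι) : l2norm (fun i => x i) = ‖x‖ :=
  (EuclideanSpace.norm_eq x).symm

lemma l2norm_toLp (x : ι → ℂ) : ‖WithLp.toLp 2 x‖ = l2norm x :=
  EuclideanSpace.norm_eq _

lemma l2norm_single [DecidableEq ι] (i : ι) : l2norm (Pi.single i (1 : ℂ)) = 1 := by
  have : ∀ j, ‖(Pi.single i (1 : ℂ) : ι → ℂ) j‖ ^ 2 = if j = i then 1 else 0 := by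
    intro j
    by_cases h : j = i
    · subst h; simp
    · simp [h]
  simp [l2norm, this]

lemma norm_sum_mul_le (y x : ι → ℂ) : ‖∑ i, y i * x i‖ ≤ l2norm y * l2norm x := by
  calc ‖∑ i, y i * x i‖ ≤ ∑ i, ‖y i‖ * ‖x i‖ := by
        refine (norm_sum_le _ _).trans (le_of_eq ?_)
        simp
    _ ≤ l2norm y * l2norm x := Real.sum_mul_le_sqrt_mul_sqrt _ _ _

lemma l2norm_le_of_sq_le {x : ι → ℂ} {c : ℝ} (hc : 0 ≤ c) (h : ∑ i, ‖x i‖ ^ 2 ≤ c ^ 2) :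
    l2norm x ≤ c := Real.sqrt_le_iff.2 ⟨hc, h⟩

lemma sum_bilin_eq (B : Matrix ι κ ℂ) (y : ι → ℂ) (x : κ → ℂ) :
    ∑ i, ∑ j, y i * B i j * x j = ∑ i, y i * B.mulVec x i := by
  simp [Matrix.mulVec, dotProduct, Finset.mul_sum, mul_assoc]

lemma BilinBound.of_mulVec {B : Matrix ι κ ℂ} {c : ℝ}
    (h : ∀ x, l2norm (B.mulVec x) ≤ c * l2norm x) : BilinBound B c := by
  intro y x
  rw [sum_bilin_eq]
  refine (norm_sum_mul_le _ _).trans ?_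
  rw [mul_comm]
  exact mul_le_mul_of_nonneg_right (h x) (l2norm_nonneg _)

/-- Testing the form against the conjugate of `B x` produces `‖B x‖²`, from which one factor
cancels. -/
lemma BilinBound.mulVec {B : Matrix ι κ ℂ} {c : ℝ} (h : BilinBound B c) (hc : 0 ≤ c)
    (x : κ → ℂ) : l2norm (B.mulVec x) ≤ c * l2norm x := by
  have h1 := h (fun i => star (B.mulVec x i)) x
  rw [sum_bilin_eq, l2norm_star] at h1
  have h2 : ∑ i, star (B.mulVec x i) * B.mulVec x i = ((l2norm (B.mulVec x) ^ 2 : ℝ) : ℂ) := by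
    rw [l2norm_sq]
    push_cast
    exact Finset.sum_congr rfl fun i _ => Complex.conj_mul' _
  rw [h2, Complex.norm_real, Real.norm_of_nonneg (sq_nonneg _), sq] at h1
  rcases (l2norm_nonneg (B.mulVec x)).eq_or_lt with h0 | h0
  · rw [← h0]; exact mul_nonneg hc (l2norm_nonneg _)
  · exact le_of_mul_le_mul_right h1 h0

lemma BilinBound.mono {B : Matrix ι κ ℂ} {c c' : ℝ} (h : BilinBound B c) (hc : c ≤ c') :
    BilinBound B c' := fun y x =>
  (h y x).trans (mul_le_mul_of_nonneg_right (mul_le_mul_of_nonneg_right hc (l2norm_nonneg _))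
    (l2norm_nonneg _))

lemma BilinBound.transpose {B : Matrix ι κ ℂ} {c : ℝ} (h : BilinBound B c) :
    BilinBound B.transpose c := by
  intro y x
  have h1 := h x y
  rw [Finset.sum_comm] at h1
  rw [mul_right_comm]
  refine le_trans (le_of_eq ?_) h1
  congr 1
  refine Finset.sum_congr rfl fun i _ => Finset.sum_congr rfl fun j _ => ?_
  rw [Matrix.transpose_apply]
  ring

lemma bilinBound_spectralNorm [DecidableEq ι] (B : Matrix ι ι ℂ) :
    BilinBound B (spectralNorm B) := by
  refine BilinBound.of_mulVec fun x => ?_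
  have h := (Matrix.toEuclideanCLM (n := ι) (𝕜 := ℂ) B).le_opNorm (WithLp.toLp 2 x)
  rwa [Matrix.toEuclideanCLM_toLp, l2norm_toLp, l2norm_toLp] at h

lemma spectralNorm_nonneg [DecidableEq ι] (B : Matrix ι ι ℂ) : 0 ≤ spectralNorm B :=
  norm_nonneg _

/-- The operator norm is at most the Hilbert-Schmidt norm. -/
lemma bilinBound_hilbertSchmidt (B : Matrix ι κ ℂ) :
    BilinBound B (√(∑ i, ∑ j, ‖B i j‖ ^ 2)) := by
  refine BilinBound.of_mulVec fun x => ?_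
  refine l2norm_le_of_sq_le (mul_nonneg (Real.sqrt_nonneg _) (l2norm_nonneg _)) ?_
  rw [mul_pow, Real.sq_sqrt (Finset.sum_nonneg fun _ _ => Finset.sum_nonneg fun _ _ =>
    sq_nonneg _), Finset.sum_mul]
  refine Finset.sum_le_sum fun i _ => ?_
  have h := norm_sum_mul_le (B i) x
  have h2 : ‖B.mulVec x i‖ ^ 2 ≤ (l2norm (B i) * l2norm x) ^ 2 :=
    pow_le_pow_left₀ (norm_nonneg _) h 2
  rwa [mul_pow, l2norm_sq (B i)] at h2

/-- `B` acts on the second index and then `A` on the first; slice by slice each step costs its own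
constant. -/
lemma BilinBound.kronecker {A : Matrix ι κ ℂ} {B : Matrix τ υ ℂ} {a b : ℝ}
    (hA : BilinBound A a) (hB : BilinBound B b) (ha : 0 ≤ a) (hb : 0 ≤ b) :
    BilinBound (A ⊗ₖ B) (a * b) := by
  have sqA : ∀ x, ∑ i, ‖A.mulVec x i‖ ^ 2 ≤ a ^ 2 * ∑ j, ‖x j‖ ^ 2 := fun x => by
    rw [← l2norm_sq, ← l2norm_sq, ← mul_pow]
    exact pow_le_pow_left₀ (l2norm_nonneg _) (hA.mulVec ha x) 2
  have sqB : ∀ x, ∑ i, ‖B.mulVec x i‖ ^ 2 ≤ b ^ 2 * ∑ j, ‖x j‖ ^ 2 := fun x => by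
    rw [← l2norm_sq, ← l2norm_sq, ← mul_pow]
    exact pow_le_pow_left₀ (l2norm_nonneg _) (hB.mulVec hb x) 2
  refine BilinBound.of_mulVec fun x => ?_
  refine l2norm_le_of_sq_le (mul_nonneg (mul_nonneg ha hb) (l2norm_nonneg _)) ?_
  have hx : ∀ i j, (A ⊗ₖ B).mulVec x (i, j) =
      A.mulVec (fun k => B.mulVec (fun l => x (k, l)) j) i := by
    intro i j
    simp only [Matrix.mulVec, dotProduct, Matrix.kroneckerMap_apply, Fintype.sum_prod_type,
      Finset.mul_sum, mul_assoc]
  rw [Fintype.sum_prod_type_right, mul_pow, mul_pow, l2norm_sq, Fintype.sum_prod_type]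
  calc ∑ j, ∑ i, ‖(A ⊗ₖ B).mulVec x (i, j)‖ ^ 2
      ≤ ∑ j, a ^ 2 * ∑ k, ‖B.mulVec (fun l => x (k, l)) j‖ ^ 2 := by
        refine Finset.sum_le_sum fun j _ => ?_
        simp only [hx]
        exact sqA _
    _ = a ^ 2 * ∑ k, ∑ j, ‖B.mulVec (fun l => x (k, l)) j‖ ^ 2 := by
        rw [← Finset.mul_sum, Finset.sum_comm]
    _ ≤ a ^ 2 * ∑ k, b ^ 2 * ∑ l, ‖x (k, l)‖ ^ 2 := by
        refine mul_le_mul_of_nonneg_left (Finset.sum_le_sum fun k _ => sqB _) (sq_nonneg _)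
    _ = a ^ 2 * b ^ 2 * ∑ k, ∑ l, ‖x (k, l)‖ ^ 2 := by
        rw [← Finset.mul_sum, mul_assoc]

lemma sum_l2norm_mask_sq_le {α : Type*} [DecidableEq α] (s : Finset α) (k : ι → α) (z : ι → ℂ) :
    ∑ μ ∈ s, l2norm (fun j => if k j = μ then z j else 0) ^ 2 ≤ ∑ j, ‖z j‖ ^ 2 := by
  simp only [l2norm_sq]
  rw [Finset.sum_comm]
  refine Finset.sum_le_sum fun j _ => ?_
  have : ∀ μ, ‖if k j = μ then z j else 0‖ ^ 2 = if k j = μ then ‖z j‖ ^ 2 else 0 := by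
    intro μ; split_ifs <;> simp
  simp only [this, Finset.sum_ite_eq]
  split_ifs
  · exact le_rfl
  · exact sq_nonneg _

/-- Keeping only the blocks on which a row label and a column label agree does not increase the
operator norm. -/
lemma BilinBound.mask {α : Type*} [DecidableEq α] {B : Matrix ι κ ℂ} {c : ℝ} (h : BilinBound B c)
    (hc : 0 ≤ c) (f : ι → α) (g : κ → α) :
    BilinBound (Matrix.of fun i j => if f i = g j then B i j else 0) c := by
  intro y x
  set s : Finset α := Finset.univ.image f
  -- The masked form is the sum over labels `μ` of the original form on the `μ`-slices of `y` and
  -- `x`. The slices are orthogonal, so Cauchy-Schwarz over `μ` recovers the full norms.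
  have key : ∑ i, ∑ j, y i * (Matrix.of fun i j => if f i = g j then B i j else 0) i j * x j =
      ∑ μ ∈ s, ∑ i, ∑ j, (if f i = μ then y i else 0) * B i j * (if g j = μ then x j else 0) := by
    rw [Finset.sum_comm (s := s)]
    refine Finset.sum_congr rfl fun i _ => ?_
    rw [Finset.sum_comm (s := s)]
    refine Finset.sum_congr rfl fun j _ => ?_
    rw [Finset.sum_eq_single (f i)]
    · by_cases hij : f i = g j
      · simp [hij]
      · simp [hij, Ne.symm hij]
    · intro μ _ hμ
      simp [hμ.symm]
    · intro hn
      exact absurd (Finset.mem_image_of_mem f (Finset.mem_univ i)) hn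
  rw [key]
  calc _ ≤ ∑ μ ∈ s, c * (l2norm (fun j => if g j = μ then x j else 0) *
        l2norm (fun i => if f i = μ then y i else 0)) := by
        refine (norm_sum_le _ _).trans (Finset.sum_le_sum fun μ _ => ?_)
        rw [← mul_assoc]
        exact h _ _
    _ ≤ c * (l2norm x * l2norm y) := by
        rw [← Finset.mul_sum]
        refine mul_le_mul_of_nonneg_left ?_ hc
        refine (Real.sum_mul_le_sqrt_mul_sqrt _ _ _).trans ?_
        exact mul_le_mul (Real.sqrt_le_sqrt (sum_l2norm_mask_sq_le s g x))
          (Real.sqrt_le_sqrt (sum_l2norm_mask_sq_le s f y)) (Real.sqrt_nonneg _)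
          (Real.sqrt_nonneg _)
    _ = c * l2norm x * l2norm y := by ring

/-! ### Schatten norms -/

variable [DecidableEq ι]

lemma sum_eigenvalues_conjTranspose_mul_self (A : Matrix ι ι ℂ) :
    ∑ i, (Matrix.isHermitian_conjTranspose_mul_self A).eigenvalues i = ∑ i, ∑ j, ‖A i j‖ ^ 2 := by
  have h := (Matrix.isHermitian_conjTranspose_mul_self A).trace_eq_sum_eigenvalues
  have h2 : (A.conjTranspose * A).trace = ((∑ i, ∑ j, ‖A i j‖ ^ 2 : ℝ) : ℂ) := by
    rw [Finset.sum_comm]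
    simp only [Matrix.trace, Matrix.diag, Matrix.mul_apply, Matrix.conjTranspose_apply]
    push_cast
    exact Finset.sum_congr rfl fun i _ => Finset.sum_congr rfl fun j _ => Complex.conj_mul' _
  rw [h2] at h
  have h3 := congrArg Complex.re h
  simp only [Complex.ofReal_re, Complex.re_sum, Complex.coe_algebraMap] at h3
  rw [h3]

lemma eigenvalues_conjTranspose_mul_self_nonneg (A : Matrix ι ι ℂ) (i : ι) :
    0 ≤ (Matrix.isHermitian_conjTranspose_mul_self A).eigenvalues i := by
  open scoped ComplexOrder in
  exact (Matrix.posSemidef_conjTranspose_mul_self A).eigenvalues_nonneg i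

lemma schattenNorm_two_sq (A : Matrix ι ι ℂ) :
    schattenNorm 2 A ^ 2 = ∑ i, ∑ j, ‖A i j‖ ^ 2 := by
  rw [← sum_eigenvalues_conjTranspose_mul_self]
  have h0 : (0 : ℝ) ≤ ∑ i, (√((Matrix.isHermitian_conjTranspose_mul_self A).eigenvalues i))
      ^ (2 : ℝ) := Finset.sum_nonneg fun i _ => Real.rpow_nonneg (Real.sqrt_nonneg _) _
  rw [schattenNorm, ← Real.sqrt_eq_rpow, Real.sq_sqrt h0]
  refine Finset.sum_congr rfl fun i _ => ?_
  rw [Real.rpow_two, Real.sq_sqrt (eigenvalues_conjTranspose_mul_self_nonneg A i)]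

lemma schattenNorm_one (A : Matrix ι ι ℂ) :
    schattenNorm 1 A = ∑ i, √((Matrix.isHermitian_conjTranspose_mul_self A).eigenvalues i) := by
  simp [schattenNorm]

lemma sum_sq_le_schattenNorm_one_sq (A : Matrix ι ι ℂ) :
    ∑ i, ∑ j, ‖A i j‖ ^ 2 ≤ schattenNorm 1 A ^ 2 := by
  rw [← sum_eigenvalues_conjTranspose_mul_self, schattenNorm_one]
  have h := Finset.sum_sq_le_sq_sum_of_nonneg (s := Finset.univ)
    (f := fun i => √((Matrix.isHermitian_conjTranspose_mul_self A).eigenvalues i))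
    fun i _ => Real.sqrt_nonneg _
  refine le_trans (le_of_eq (Finset.sum_congr rfl fun i _ => ?_)) h
  rw [Real.sq_sqrt (eigenvalues_conjTranspose_mul_self_nonneg A i)]

/-- Duality between the trace norm and the operator norm. -/
lemma BilinBound.norm_trace_mul_le {B : Matrix ι ι ℂ} {c : ℝ} (h : BilinBound B c)
    (A : Matrix ι ι ℂ) : ‖∑ s, ∑ r, B s r * A r s‖ ≤ c * schattenNorm 1 A := by
  set hH := Matrix.isHermitian_conjTranspose_mul_self A
  set u := hH.eigenvectorBasis
  have hu : ∀ r s : ι, ∑ i, u i r * star (u i s) = if r = s then 1 else 0 := by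
    intro r s
    have h1 := OrthonormalBasis.sum_inner_mul_inner u (EuclideanSpace.single r (1 : ℂ))
      (EuclideanSpace.single s (1 : ℂ))
    simp only [EuclideanSpace.inner_single_left, EuclideanSpace.inner_single_right] at h1
    simpa [Pi.single_apply, eq_comm] using h1
  -- Inserting the eigenbasis `u` of `A† A` writes `Tr (B A)` as the sum of `⟨u i, B A u i⟩`, where
  -- `‖A u i‖` is the `i`-th singular value of `A`.
  have hexp : ∑ s, ∑ r, B s r * A r s =
      ∑ i, ∑ s, ∑ r, star (u i s) * B s r * A.mulVec (u i) r := by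
    rw [Finset.sum_comm (s := (Finset.univ : Finset ι)) (t := (Finset.univ : Finset ι))
      (f := fun i s => ∑ r, star (u i s) * B s r * A.mulVec (u i) r)]
    refine Finset.sum_congr rfl fun s _ => ?_
    rw [Finset.sum_comm]
    refine Finset.sum_congr rfl fun r _ => ?_
    calc B s r * A r s = B s r * ∑ t, A r t * (if t = s then 1 else 0) := by simp
      _ = B s r * ∑ t, A r t * ∑ i, u i t * star (u i s) := by simp only [hu]
      _ = ∑ i, star (u i s) * B s r * A.mulVec (u i) r := by
        simp only [Matrix.mulVec, dotProduct, Finset.mul_sum]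
        rw [Finset.sum_comm]
        refine Finset.sum_congr rfl fun i _ => Finset.sum_congr rfl fun t _ => ?_
        ring
  rw [hexp, schattenNorm_one, Finset.mul_sum]
  refine (norm_sum_le _ _).trans (Finset.sum_le_sum fun i _ => ?_)
  have h1 := h (fun s => star (u i s)) (A.mulVec (u i))
  rw [l2norm_star, l2norm_eq_norm, u.orthonormal.1 i, mul_one] at h1
  refine h1.trans (le_of_eq ?_)
  congr 1
  have h2 : ((l2norm (A.mulVec (u i)) ^ 2 : ℝ) : ℂ) = (hH.eigenvalues i : ℂ) := by
    have e1 : ((l2norm (A.mulVec (u i)) ^ 2 : ℝ) : ℂ) =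
        dotProduct (star (A.mulVec (u i))) (A.mulVec (u i)) := by
      rw [l2norm_sq]
      push_cast
      exact Finset.sum_congr rfl fun i _ => (Complex.conj_mul' _).symm
    rw [e1, Matrix.star_mulVec, ← Matrix.dotProduct_mulVec, Matrix.mulVec_mulVec,
      hH.mulVec_eigenvectorBasis i, dotProduct_smul]
    have e2 : dotProduct (star (u i).ofLp) (u i).ofLp = 1 := by
      have : ((l2norm (fun s => u i s) ^ 2 : ℝ) : ℂ) = 1 := by
        rw [l2norm_eq_norm, u.orthonormal.1 i]; simp
      rw [← this, l2norm_sq]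
      push_cast
      exact Finset.sum_congr rfl fun i _ => (Complex.conj_mul' _)
    rw [e2]
    simp
  have h3 : l2norm (A.mulVec (u i)) ^ 2 = hH.eigenvalues i := by exact_mod_cast h2
  change _ = √(hH.eigenvalues i)
  rw [← h3, Real.sqrt_sq (l2norm_nonneg _)]

/-- The trace norm of a rank one matrix. -/
lemma schattenNorm_one_vecMulVec (x y : ι → ℂ) :
    schattenNorm 1 (Matrix.of fun i j => x i * star (y j)) = l2norm x * l2norm y := by
  set A : Matrix ι ι ℂ := Matrix.of fun i j => x i * star (y j) with hA
  set hH := Matrix.isHermitian_conjTranspose_mul_self A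
  set m := l2norm x * l2norm y with hm
  have hm0 : 0 ≤ m := mul_nonneg (l2norm_nonneg _) (l2norm_nonneg _)
  have hsum : ∑ i, hH.eigenvalues i = m ^ 2 := by
    rw [sum_eigenvalues_conjTranspose_mul_self, mul_pow, l2norm_sq, l2norm_sq,
      Finset.sum_mul_sum]
    simp [hA, mul_pow]
  have hx : ∑ i, star (x i) * x i = ((l2norm x ^ 2 : ℝ) : ℂ) := by
    rw [l2norm_sq]
    push_cast
    exact Finset.sum_congr rfl fun i _ => (Complex.conj_mul' _)
  have hy : ∑ i, star (y i) * y i = ((l2norm y ^ 2 : ℝ) : ℂ) := by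
    rw [l2norm_sq]
    push_cast
    exact Finset.sum_congr rfl fun i _ => (Complex.conj_mul' _)
  have hG : ∀ i j, (A.conjTranspose * A) i j = ((l2norm x ^ 2 : ℝ) : ℂ) * (y i * star (y j)) := by
    intro i j
    rw [← hx, Finset.sum_mul, Matrix.mul_apply]
    refine Finset.sum_congr rfl fun k _ => ?_
    simp [hA]
    ring
  -- `A† A` squares to `m²` times itself, so its eigenvalues are `0` or `m²`. On both values `m √λ =
  -- λ`, and the trace `m²` then fixes the sum of the roots.
  have hsq : (A.conjTranspose * A) * (A.conjTranspose * A) =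
      ((m ^ 2 : ℝ) : ℂ) • (A.conjTranspose * A) := by
    ext i j
    rw [Matrix.mul_apply, Matrix.smul_apply]
    simp only [hG]
    rw [hm, mul_pow, Complex.ofReal_mul, ← hy, smul_eq_mul, Finset.mul_sum, Finset.sum_mul]
    refine Finset.sum_congr rfl fun k _ => ?_
    ring
  have hev : ∀ i, hH.eigenvalues i * hH.eigenvalues i = m ^ 2 * hH.eigenvalues i := by
    intro i
    have h1 := hH.mulVec_eigenvectorBasis i
    have h2 : ((A.conjTranspose * A) * (A.conjTranspose * A)).mulVec (hH.eigenvectorBasis i).ofLp =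
        (hH.eigenvalues i * hH.eigenvalues i) • (hH.eigenvectorBasis i).ofLp := by
      rw [← Matrix.mulVec_mulVec, h1, Matrix.mulVec_smul, h1, smul_smul]
    rw [hsq, Matrix.smul_mulVec, h1] at h2
    have h3 : hH.eigenvectorBasis i ≠ 0 := hH.eigenvectorBasis.orthonormal.ne_zero i
    obtain ⟨k, hk⟩ : ∃ k, (hH.eigenvectorBasis i) k ≠ 0 := by
      by_contra hcon
      push Not at hcon
      exact h3 (by ext k; simpa using hcon k)
    have h4 := congrFun h2 k
    simp only [Pi.smul_apply, Complex.real_smul, smul_eq_mul, ← mul_assoc] at h4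
    have h5 := mul_right_cancel₀ hk h4
    have h6 : ((m ^ 2 * hH.eigenvalues i : ℝ) : ℂ) =
        ((hH.eigenvalues i * hH.eigenvalues i : ℝ) : ℂ) := by
      rw [Complex.ofReal_mul]; exact h5
    exact (Complex.ofReal_injective h6).symm
  have hroot : ∀ i, m * √(hH.eigenvalues i) = hH.eigenvalues i := by
    intro i
    have h0 := eigenvalues_conjTranspose_mul_self_nonneg A i
    rcases h0.eq_or_lt with h | h
    · change 0 = hH.eigenvalues i at h
      rw [← h]; simp
    · have h1 := mul_right_cancel₀ h.ne' (hev i)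
      rw [h1, Real.sqrt_sq hm0, sq]
  rw [schattenNorm_one]
  rcases hm0.eq_or_lt with h | h
  · rw [← h]
    have hz : ∀ i, hH.eigenvalues i = 0 := fun i => by rw [← hroot i, ← h, zero_mul]
    exact Finset.sum_eq_zero fun i _ => by
      change √(hH.eigenvalues i) = 0
      rw [hz i, Real.sqrt_zero]
  · refine mul_left_cancel₀ h.ne' ?_
    rw [Finset.mul_sum, ← sq, ← hsum]
    exact Finset.sum_congr rfl fun i _ => hroot i

/-! ### The diamond norm as a bound on bilinear forms -/

/-- A superoperator of small diamond norm maps rank one operators to functionals that are small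
on operators of bounded operator norm. -/
lemma norm_sum_le_of_diamondNorm_le {S : Matrix (ι × ι) (ι × ι) ℂ} {ε : ℝ}
    (hS : diamondNorm S ≤ ENNReal.ofReal ε) (hε : 0 ≤ ε) {B : Matrix ι ι ℂ} {c : ℝ}
    (hB : BilinBound B c) (hc : 0 ≤ c) (x y : ι → ℂ) :
    ‖∑ s, ∑ r, B s r * ∑ p : ι × ι, S (r, s) p * (x p.1 * y p.2)‖ ≤
      c * ε * l2norm x * l2norm y := by
  have hnn : 0 ≤ c * ε * l2norm x * l2norm y :=
    mul_nonneg (mul_nonneg (mul_nonneg hc hε) (l2norm_nonneg _)) (l2norm_nonneg _)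
  by_cases hx : ∃ i, x i ≠ 0
  swap
  · push Not at hx
    simpa [hx] using hnn
  by_cases hy : ∃ i, y i ≠ 0
  swap
  · push Not at hy
    simpa [hy] using hnn
  obtain ⟨i₀, hi₀⟩ := hx
  obtain ⟨j₀, hj₀⟩ := hy
  -- A trivial ancilla suffices: only the trace norm of the image of one rank one operator is used.
  set x' : ι × Fin 1 → ℂ := fun a => x a.1
  set y' : ι × Fin 1 → ℂ := fun a => star (y a.1)
  have lx : l2norm x' = l2norm x := by simp [l2norm, x', Fintype.sum_prod_type]
  have ly : l2norm y' = l2norm y := by simp [l2norm, y', Fintype.sum_prod_type]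
  set X : Matrix (ι × Fin 1) (ι × Fin 1) ℂ := Matrix.of fun i j => x' i * star (y' j) with hX
  have hX0 : X ≠ 0 := by
    intro h0
    have := congrFun (congrFun h0 (i₀, 0)) (j₀, 0)
    simp [hX, x', y', hi₀, hj₀] at this
  have hpos : 0 < schattenNorm 1 X := by
    rw [schattenNorm_one_vecMulVec, lx, ly]
    exact mul_pos (l2norm_pos hi₀) (l2norm_pos hj₀)
  have hle : schattenNorm 1 (ampliate S 1 X) ≤ ε * (l2norm x * l2norm y) := by
    have h1 : ENNReal.ofReal (schattenNorm 1 (ampliate S 1 X) / schattenNorm 1 X) ≤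
        ENNReal.ofReal ε := by
      refine le_trans ?_ hS
      exact le_iSup_of_le 1 (le_iSup_of_le X (le_iSup_of_le hX0 le_rfl))
    rw [ENNReal.ofReal_le_ofReal_iff hε, div_le_iff₀ hpos, schattenNorm_one_vecMulVec, lx,
      ly] at h1
    exact h1
  have hB' : BilinBound (Matrix.of fun a b : ι × Fin 1 => B a.1 b.1) c := by
    intro y x
    have := hB (fun i => y (i, 0)) (fun i => x (i, 0))
    simpa [l2norm, Fintype.sum_prod_type] using this
  have h2 := hB'.norm_trace_mul_le (ampliate S 1 X)
  have h3 : ∑ s, ∑ r, B s r * ∑ p : ι × ι, S (r, s) p * (x p.1 * y p.2) =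
      ∑ s, ∑ r, (Matrix.of fun a b : ι × Fin 1 => B a.1 b.1) s r * ampliate S 1 X r s := by
    simp [Fintype.sum_prod_type, ampliate, hX, x', y']
  rw [h3]
  refine h2.trans ((mul_le_mul_of_nonneg_left hle hc).trans (le_of_eq ?_))
  ring

end LinearAlgebra

/-! ### Haar measure and the commutant of `g ⊗ g` -/

section Haar

variable {d : ℕ}

instance instIsHaarMeasureHaarU : (haarU d).IsHaarMeasure := by
  unfold haarU
  infer_instance

instance instIsProbabilityMeasureHaarU : IsProbabilityMeasure (haarU d) :=
  ⟨Measure.haarMeasure_self (K₀ := (⊤ : TopologicalSpace.PositiveCompacts (U d)))⟩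

/-- A right translate of Haar measure is again a Haar probability measure, hence equal to it by
uniqueness. -/
instance instIsMulRightInvariantHaarU : (haarU d).IsMulRightInvariant := by
  refine ⟨fun g => ?_⟩
  have : IsProbabilityMeasure ((haarU d).map (· * g)) :=
    Measure.isProbabilityMeasure_map (measurable_mul_const g).aemeasurable
  exact Measure.isHaarMeasure_eq_of_isProbabilityMeasure _ _

/-- Continuous functions of a random unitary are integrable. -/
lemma integrable_comp {Ω : Type*} [MeasurableSpace Ω] {P : Measure Ω} [IsFiniteMeasure P]
    {W : Ω → U d} (hW : Measurable W) {f : U d → ℂ} (hf : Continuous f) :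
    Integrable (fun θ => f (W θ)) P := by
  obtain ⟨C, hC⟩ := isCompact_univ.exists_bound_of_continuousOn (hf.continuousOn (s := Set.univ))
  exact Integrable.of_bound (hf.measurable.comp hW).aestronglyMeasurable C
    (Filter.Eventually.of_forall fun θ => hC _ (Set.mem_univ _))

lemma continuous_entry (i j : Fin d) :
    Continuous fun W : U d => (W : Matrix (Fin d) (Fin d) ℂ) i j :=
  continuous_subtype_val.matrix_elem i j

lemma coe_inv_unitary (g : U d) :
    ((g⁻¹ : U d) : Matrix (Fin d) (Fin d) ℂ) = (g : Matrix (Fin d) (Fin d) ℂ).conjTranspose := rfl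

lemma conjTranspose_mul_self_unitary (g : U d) :
    (g : Matrix (Fin d) (Fin d) ℂ).conjTranspose * (g : Matrix (Fin d) (Fin d) ℂ) = 1 :=
  Matrix.UnitaryGroup.star_mul_self g

lemma mul_conjTranspose_self_unitary (g : U d) :
    (g : Matrix (Fin d) (Fin d) ℂ) * (g : Matrix (Fin d) (Fin d) ℂ).conjTranspose = 1 :=
  Matrix.mem_unitaryGroup_iff.1 g.2

/-- A diagonal unitary with phase `i` at position `k`. -/
noncomputable def phaseUnitary (k : Fin d) : U d :=
  ⟨Matrix.diagonal fun j => if j = k then Complex.I else 1, by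
    rw [Matrix.mem_unitaryGroup_iff, Matrix.star_eq_conjTranspose, Matrix.diagonal_conjTranspose,
      Matrix.diagonal_mul_diagonal, ← Matrix.diagonal_one]
    congr 1
    funext j
    by_cases h : j = k <;> simp [h]⟩

/-- A permutation unitary. -/
noncomputable def permUnitary (σ : Equiv.Perm (Fin d)) : U d :=
  ⟨σ.permMatrix ℂ, by
    rw [Matrix.mem_unitaryGroup_iff, Matrix.star_eq_conjTranspose, Matrix.conjTranspose_permMatrix,
      ← Matrix.permMatrix_mul]
    simp⟩

/-- The square root `((1 + i) + (1 - i) S) / 2` of a transposition `S`. -/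
noncomputable def sqrtSwapUnitary (a b : Fin d) : U d :=
  ⟨((1 + Complex.I) / 2) • (1 : Matrix (Fin d) (Fin d) ℂ) +
      ((1 - Complex.I) / 2) • (Equiv.swap a b).permMatrix ℂ, by
    have hS : (Equiv.swap a b).permMatrix ℂ * (Equiv.swap a b).permMatrix ℂ = 1 := by
      rw [← Matrix.permMatrix_mul]; simp
    have hI := Complex.I_mul_I
    have e1 : (1 + Complex.I) / 2 * ((1 - Complex.I) / 2) = 1 / 2 := by
      linear_combination (-1 / 4) * hI
    have e2 : (1 + Complex.I) / 2 * ((1 + Complex.I) / 2) = Complex.I / 2 := by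
      linear_combination (1 / 4) * hI
    have e3 : (1 - Complex.I) / 2 * ((1 - Complex.I) / 2) = -(Complex.I / 2) := by
      linear_combination (1 / 4) * hI
    rw [Matrix.mem_unitaryGroup_iff, Matrix.star_eq_conjTranspose, Matrix.conjTranspose_add,
      Matrix.conjTranspose_smul, Matrix.conjTranspose_smul, Matrix.conjTranspose_permMatrix,
      Equiv.swap_inv, Matrix.conjTranspose_one]
    have s1 : star ((1 + Complex.I) / 2) = (1 - Complex.I) / 2 := by simp [sub_eq_add_neg]
    have s2 : star ((1 - Complex.I) / 2) = (1 + Complex.I) / 2 := by simp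
    rw [s1, s2, add_mul, mul_add, mul_add]
    simp only [smul_mul_smul_comm, one_mul, mul_one, hS]
    rw [mul_comm ((1 - Complex.I) / 2) ((1 + Complex.I) / 2), e1, e2, e3]
    module⟩

lemma kronecker_permMatrix_mul_apply (σ : Equiv.Perm (Fin d)) (τ : Equiv.Perm (Fin d))
    (N : Matrix (Idx d) (Idx d) ℂ) (r s : Idx d) :
    ((σ.permMatrix ℂ ⊗ₖ τ.permMatrix ℂ) * N) r s = N (σ r.1, τ r.2) s := by
  rw [Matrix.mul_apply, Fintype.sum_prod_type]
  simp [Matrix.kroneckerMap_apply, Equiv.Perm.permMatrix, PEquiv.toMatrix_apply,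
    Equiv.toPEquiv_apply]

lemma mul_kronecker_permMatrix_apply (σ : Equiv.Perm (Fin d)) (τ : Equiv.Perm (Fin d))
    (N : Matrix (Idx d) (Idx d) ℂ) (r s : Idx d) :
    (N * (σ.permMatrix ℂ ⊗ₖ τ.permMatrix ℂ)) r (σ s.1, τ s.2) = N r s := by
  rw [Matrix.mul_apply, Fintype.sum_prod_type]
  simp [Matrix.kroneckerMap_apply, Equiv.Perm.permMatrix, PEquiv.toMatrix_apply,
    Equiv.toPEquiv_apply]

lemma exists_perm_map_pair {a₀ b₀ a b : Fin d} (h₀ : a₀ ≠ b₀) (h : a ≠ b) :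
    ∃ σ : Equiv.Perm (Fin d), σ a₀ = a ∧ σ b₀ = b := by
  refine ⟨Equiv.swap (Equiv.swap a₀ a b₀) b * Equiv.swap a₀ a, ?_, ?_⟩
  · rw [Equiv.Perm.mul_apply, Equiv.swap_apply_left]
    refine Equiv.swap_apply_of_ne_of_ne (fun he => h₀ ?_) h
    exact (Equiv.swap a₀ a).injective (by rw [Equiv.swap_apply_left]; exact he)
  · rw [Equiv.Perm.mul_apply, Equiv.swap_apply_left]

/-- A matrix commuting with all `g ⊗ g` is a combination of the identity and the swap. -/
theorem exists_eq_of_commute_kronecker (hd : 2 ≤ d) (N : Matrix (Idx d) (Idx d) ℂ)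
    (hN : ∀ g : U d, ((g : Matrix (Fin d) (Fin d) ℂ) ⊗ₖ (g : Matrix (Fin d) (Fin d) ℂ)) * N =
      N * ((g : Matrix (Fin d) (Fin d) ℂ) ⊗ₖ (g : Matrix (Fin d) (Fin d) ℂ))) :
    ∃ α β : ℂ, ∀ r s, N r s = α * (if r.1 = s.1 ∧ r.2 = s.2 then 1 else 0) +
      β * (if r.1 = s.2 ∧ r.2 = s.1 then 1 else 0) := by
  -- The phase at `k` compares `i` raised to the multiplicities of `k` in `r` and in `s`. Since `1,
  -- i, -1` are distinct, a nonzero entry forces equal multisets.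
  have hphase : ∀ r s, N r s ≠ 0 → (r.1 = s.1 ∧ r.2 = s.2) ∨ (r.1 = s.2 ∧ r.2 = s.1) := by
    intro r s h0
    have hz : ∀ k : Fin d, (if r.1 = k then Complex.I else 1) * (if r.2 = k then Complex.I else 1) =
        (if s.1 = k then Complex.I else 1) * (if s.2 = k then Complex.I else 1) := by
      intro k
      have h1 := congrFun (congrFun (hN (phaseUnitary k)) r) s
      simp only [phaseUnitary, Matrix.diagonal_kronecker_diagonal, Matrix.diagonal_mul,
        Matrix.mul_diagonal] at h1
      rw [mul_comm (N r s)] at h1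
      exact mul_right_cancel₀ h0 h1
    have hI1 : Complex.I ≠ 1 := fun h => by simpa using congrArg Complex.im h
    have hI2 : Complex.I * Complex.I ≠ 1 := by rw [Complex.I_mul_I]; norm_num
    by_cases h1 : r.1 = s.1
    · left
      refine ⟨h1, ?_⟩
      by_contra h2
      have h3 := hz r.2
      rw [h1] at h3
      have h4 : (if s.1 = r.2 then Complex.I else 1) ≠ 0 := by
        split_ifs
        · exact Complex.I_ne_zero
        · exact one_ne_zero
      have h5 := mul_left_cancel₀ h4 h3
      rw [if_pos rfl, if_neg (Ne.symm h2)] at h5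
      exact hI1 h5
    · right
      by_cases h2 : r.1 = s.2
      · refine ⟨h2, ?_⟩
        by_contra h6
        have h3 := hz r.2
        rw [h2, mul_comm (if s.1 = r.2 then Complex.I else 1)] at h3
        have h4 : (if s.2 = r.2 then Complex.I else 1) ≠ 0 := by
          split_ifs
          · exact Complex.I_ne_zero
          · exact one_ne_zero
        have h5 := mul_left_cancel₀ h4 h3
        rw [if_pos rfl, if_neg (Ne.symm h6)] at h5
        exact hI1 h5
      · exfalso
        have h3 := hz r.1
        rw [if_pos rfl, if_neg (Ne.symm h1), if_neg (Ne.symm h2), one_mul] at h3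
        split_ifs at h3
        · exact hI2 h3
        · exact hI1 (by simpa using h3)
  have hperm : ∀ (σ : Equiv.Perm (Fin d)) (a b c e : Fin d),
      N (σ a, σ b) (σ c, σ e) = N (a, b) (c, e) := by
    intro σ a b c e
    have h1 := congrFun (congrFun (hN (permUnitary σ)) (a, b)) (σ c, σ e)
    simp only [permUnitary] at h1
    rwa [kronecker_permMatrix_mul_apply, mul_kronecker_permMatrix_apply σ σ N (a, b) (c, e)] at h1
  -- Phases and permutations leave three constants free; a unitary mixing two basis vectors gives
  -- the missing relation. In the square root of `S`, the `1 ⊗ 1` and `S ⊗ S` parts already commute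
  -- with `N`, so `S ⊗ 1 + 1 ⊗ S` does too; the entry `(a, a), (a, b)` is then read off.
  have hmix : ∀ a b : Fin d, a ≠ b → N (a, a) (a, a) = N (a, b) (a, b) + N (a, b) (b, a) := by
    intro a b hab
    set S := (Equiv.swap a b).permMatrix ℂ with hS
    have h1 := hN (sqrtSwapUnitary a b)
    have h2 := hN (permUnitary (Equiv.swap a b))
    simp only [sqrtSwapUnitary, permUnitary] at h1 h2
    rw [← hS] at h1 h2
    simp only [Matrix.add_kronecker, Matrix.kronecker_add, Matrix.smul_kronecker,
      Matrix.kronecker_smul, smul_add, smul_smul, Matrix.one_kronecker_one, add_mul, mul_add, one_mul,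
      mul_one, Matrix.smul_mul, Matrix.mul_smul, h2] at h1
    have e1 : (1 + Complex.I) / 2 * ((1 - Complex.I) / 2) = 1 / 2 := by
      linear_combination (-1 / 4) * Complex.I_mul_I
    rw [mul_comm ((1 - Complex.I) / 2) ((1 + Complex.I) / 2), e1] at h1
    have h3 : (S ⊗ₖ (1 : Matrix (Fin d) (Fin d) ℂ)) * N + ((1 : Matrix (Fin d) (Fin d) ℂ) ⊗ₖ S) * N =
        N * (S ⊗ₖ (1 : Matrix (Fin d) (Fin d) ℂ)) + N * ((1 : Matrix (Fin d) (Fin d) ℂ) ⊗ₖ S) := by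
      ext r s
      have h4 := congrFun (congrFun h1 r) s
      simp only [Matrix.add_apply, Matrix.smul_apply, smul_eq_mul] at h4 ⊢
      linear_combination 2 * h4
    have h5 := congrFun (congrFun h3 (a, a)) (a, b)
    simp only [Matrix.add_apply] at h5
    rw [hS, ← Matrix.permMatrix_one] at h5
    rw [kronecker_permMatrix_mul_apply, kronecker_permMatrix_mul_apply] at h5
    have e3 := mul_kronecker_permMatrix_apply (Equiv.swap a b) 1 N (a, a) (b, b)
    have e4 := mul_kronecker_permMatrix_apply 1 (Equiv.swap a b) N (a, a) (a, a)
    simp only [Equiv.swap_apply_left, Equiv.swap_apply_right, Equiv.Perm.one_apply] at e3 e4 h5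
    rw [e3, e4] at h5
    have e5 : N (a, a) (b, b) = 0 := by
      by_contra hne
      rcases hphase _ _ hne with h | h
      · exact hab h.1
      · exact hab h.1
    have e6 : N (b, a) (a, b) = N (a, b) (b, a) := by
      have := hperm (Equiv.swap a b) a b b a
      simpa using this
    rw [e5, zero_add, e6] at h5
    rw [← h5, add_comm]
  obtain ⟨a₀, b₀, h₀⟩ : ∃ a b : Fin d, a ≠ b :=
    ⟨⟨0, by omega⟩, ⟨1, by omega⟩, by simp⟩
  refine ⟨N (a₀, b₀) (a₀, b₀), N (a₀, b₀) (b₀, a₀), ?_⟩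
  have hgen : ∀ a b : Fin d, a ≠ b → N (a, b) (a, b) = N (a₀, b₀) (a₀, b₀) ∧
      N (a, b) (b, a) = N (a₀, b₀) (b₀, a₀) := by
    intro a b hab
    obtain ⟨σ, h1, h2⟩ := exists_perm_map_pair h₀ hab
    rw [← hperm σ a₀ b₀ a₀ b₀, ← hperm σ a₀ b₀ b₀ a₀, h1, h2]
    exact ⟨rfl, rfl⟩
  have hdiag : ∀ a : Fin d, N (a, a) (a, a) = N (a₀, b₀) (a₀, b₀) + N (a₀, b₀) (b₀, a₀) := by
    intro a
    obtain ⟨b, hb⟩ : ∃ b, a ≠ b := by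
      by_cases h : a = a₀
      · exact ⟨b₀, h ▸ h₀⟩
      · exact ⟨a₀, h⟩
    rw [hmix a b hb, (hgen a b hb).1, (hgen a b hb).2]
  rintro ⟨a, b⟩ ⟨c, e⟩
  dsimp only
  by_cases h1 : a = c ∧ b = e
  · obtain ⟨rfl, rfl⟩ := h1
    by_cases hab : a = b
    · subst hab
      simp [hdiag]
    · rw [(hgen a b hab).1]
      simp [hab]
  · by_cases h2 : a = e ∧ b = c
    · obtain ⟨rfl, rfl⟩ := h2
      have hab : a ≠ b := fun h => h1 ⟨h, h.symm⟩
      rw [(hgen a b hab).2]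
      simp [hab]
    · rw [if_neg h1, if_neg h2, mul_zero, mul_zero, add_zero]
      by_contra hne
      exact (hphase _ _ hne).elim h1 h2

end Haar

/-! ### Haar second moments of states and observables. -/

section Moments

variable {d : ℕ}

/-- Second moments of a Haar-distributed random matrix `T` with constant trace `t` and constant
`Tr (T ^ 2) = s`. -/
theorem haar_integral_kronecker (hd : 2 ≤ d) {T : U d → Matrix (Fin d) (Fin d) ℂ}
    (hT : Continuous T)
    (hinv : ∀ (g : U d) (r u : Idx d),
      ∫ W, (((g : Matrix (Fin d) (Fin d) ℂ) * T W * (g : Matrix (Fin d) (Fin d) ℂ).conjTranspose) ⊗ₖ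
        ((g : Matrix (Fin d) (Fin d) ℂ) * T W * (g : Matrix (Fin d) (Fin d) ℂ).conjTranspose)) r u
          ∂haarU d = ∫ W, (T W ⊗ₖ T W) r u ∂haarU d)
    {t s : ℂ} (ht : ∀ W, (T W).trace = t) (hs : ∀ W, (T W * T W).trace = s) (r u : Idx d) :
    ∫ W, (T W ⊗ₖ T W) r u ∂haarU d =
      ((t ^ 2 - s / d) * (if r.1 = u.1 ∧ r.2 = u.2 then 1 else 0) +
        (s - t ^ 2 / d) * (if r.1 = u.2 ∧ r.2 = u.1 then 1 else 0)) / ((d : ℂ) ^ 2 - 1) := by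
  have hcont : ∀ r u, Continuous fun W => (T W ⊗ₖ T W) r u := fun r u => by
    simp only [Matrix.kroneckerMap_apply]
    exact (hT.matrix_elem _ _).mul (hT.matrix_elem _ _)
  have hint : ∀ r u, Integrable (fun W => (T W ⊗ₖ T W) r u) (haarU d) := fun r u =>
    integrable_comp measurable_id (hcont r u)
  set N : Matrix (Idx d) (Idx d) ℂ := Matrix.of fun r u => ∫ W, (T W ⊗ₖ T W) r u ∂haarU d with hN
  have hconj : ∀ g : U d, ((g : Matrix (Fin d) (Fin d) ℂ) ⊗ₖ (g : Matrix (Fin d) (Fin d) ℂ)) * N *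
      ((g : Matrix (Fin d) (Fin d) ℂ) ⊗ₖ (g : Matrix (Fin d) (Fin d) ℂ)).conjTranspose = N := by
    intro g
    ext r u
    have h1 := hinv g r u
    simp only [Matrix.mul_kronecker_mul, ← Matrix.conjTranspose_kronecker] at h1
    change _ = ∫ W, (T W ⊗ₖ T W) r u ∂haarU d
    rw [← h1]
    simp only [Matrix.mul_apply, hN, Matrix.of_apply, Finset.sum_mul]
    rw [integral_finsetSum _ fun i _ => integrable_finsetSum _ fun j _ =>
      ((hint j i).const_mul _).mul_const _]
    refine Finset.sum_congr rfl fun i _ => ?_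
    rw [integral_finsetSum _ fun j _ => ((hint j i).const_mul _).mul_const _]
    refine Finset.sum_congr rfl fun j _ => ?_
    rw [integral_mul_const, integral_const_mul]
  have hcomm : ∀ g : U d, ((g : Matrix (Fin d) (Fin d) ℂ) ⊗ₖ (g : Matrix (Fin d) (Fin d) ℂ)) * N =
      N * ((g : Matrix (Fin d) (Fin d) ℂ) ⊗ₖ (g : Matrix (Fin d) (Fin d) ℂ)) := by
    intro g
    have h1 : ((g : Matrix (Fin d) (Fin d) ℂ) ⊗ₖ (g : Matrix (Fin d) (Fin d) ℂ)).conjTranspose *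
        ((g : Matrix (Fin d) (Fin d) ℂ) ⊗ₖ (g : Matrix (Fin d) (Fin d) ℂ)) = 1 := by
      rw [Matrix.conjTranspose_kronecker, ← Matrix.mul_kronecker_mul,
        conjTranspose_mul_self_unitary, Matrix.one_kronecker_one]
    conv_rhs => rw [← hconj g]
    rw [Matrix.mul_assoc _ _ (_ ⊗ₖ _), h1, Matrix.mul_one]
  obtain ⟨α, β, hαβ⟩ := exists_eq_of_commute_kronecker hd N hcomm
  have hd0 : (d : ℂ) ≠ 0 := by
    have : d ≠ 0 := by omega
    exact_mod_cast this
  have hd1 : (d : ℂ) ^ 2 - 1 ≠ 0 := by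
    have h : (1 : ℝ) < (d : ℝ) ^ 2 := by
      have : (2 : ℝ) ≤ d := by exact_mod_cast hd
      nlinarith
    have h2 : (d : ℝ) ^ 2 - 1 ≠ 0 := by linarith
    exact_mod_cast h2
  -- Contracting `N` with the identity and with the swap gives two linear equations for `α, β`,
  -- solvable because `d² ≠ 1`.
  have e1 : α * d ^ 2 + β * d = t ^ 2 := by
    have h1 : ∑ a, ∑ b, N (a, b) (a, b) = t ^ 2 := by
      simp only [hN, Matrix.of_apply]
      simp_rw [← integral_finsetSum _ fun b _ => hint _ _]
      rw [← integral_finsetSum _ fun a _ => integrable_finsetSum _ fun b _ => hint _ _]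
      have : ∀ W, ∑ a, ∑ b, (T W ⊗ₖ T W) (a, b) (a, b) = t ^ 2 := by
        intro W
        rw [sq, ← ht W]
        simp only [Matrix.trace, Matrix.diag, Matrix.kroneckerMap_apply, Finset.sum_mul_sum]
      simp only [this]
      simp
    rw [← h1]
    simp only [hαβ, and_self, if_true, mul_one, eq_comm, Finset.sum_add_distrib]
    simp [mul_comm, sq]
    ring
  have e2 : α * d + β * d ^ 2 = s := by
    have h1 : ∑ a, ∑ b, N (a, b) (b, a) = s := by
      simp only [hN, Matrix.of_apply]
      simp_rw [← integral_finsetSum _ fun b _ => hint _ _]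
      rw [← integral_finsetSum _ fun a _ => integrable_finsetSum _ fun b _ => hint _ _]
      have : ∀ W, ∑ a, ∑ b, (T W ⊗ₖ T W) (a, b) (b, a) = s := by
        intro W
        rw [← hs W]
        simp only [Matrix.trace, Matrix.diag, Matrix.kroneckerMap_apply, Matrix.mul_apply]
      simp only [this]
      simp
    rw [← h1]
    simp only [hαβ, and_self, if_true, mul_one, Finset.sum_add_distrib]
    have h3 : ∀ a b : Fin d, (a = b ∧ b = a) ↔ b = a := fun a b => ⟨fun h => h.2, fun h => ⟨h.symm, h⟩⟩
    simp [mul_comm, sq, h3]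
    ring
  have hα : α = (t ^ 2 - s / d) / ((d : ℂ) ^ 2 - 1) := by
    rw [← e1, ← e2]; field_simp; ring
  have hβ : β = (s - t ^ 2 / d) / ((d : ℂ) ^ 2 - 1) := by
    rw [← e1, ← e2]; field_simp; ring
  change N r u = _
  rw [hαβ, hα, hβ]
  ring

/-- The observable `W† O W` in the Heisenberg picture. -/
noncomputable def heisenberg (O : Matrix (Fin d) (Fin d) ℂ) (W : U d) : Matrix (Fin d) (Fin d) ℂ :=
  (W : Matrix (Fin d) (Fin d) ℂ).conjTranspose * O * (W : Matrix (Fin d) (Fin d) ℂ)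

lemma continuous_heisenberg (O : Matrix (Fin d) (Fin d) ℂ) : Continuous (heisenberg O) := by
  have h : Continuous fun W : U d => (W : Matrix (Fin d) (Fin d) ℂ) := continuous_subtype_val
  exact (h.matrix_conjTranspose.matrix_mul continuous_const).matrix_mul h

lemma trace_heisenberg (O : Matrix (Fin d) (Fin d) ℂ) (W : U d) :
    (heisenberg O W).trace = O.trace := by
  rw [heisenberg, Matrix.trace_mul_comm, ← Matrix.mul_assoc, mul_conjTranspose_self_unitary,
    Matrix.one_mul]

lemma heisenberg_mul (O O' : Matrix (Fin d) (Fin d) ℂ) (W : U d) :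
    heisenberg O W * heisenberg O' W = heisenberg (O * O') W := by
  simp only [heisenberg, Matrix.mul_assoc]
  rw [← Matrix.mul_assoc (W : Matrix (Fin d) (Fin d) ℂ) (W : Matrix (Fin d) (Fin d) ℂ).conjTranspose,
    mul_conjTranspose_self_unitary, Matrix.one_mul]

lemma heisenberg_isHermitian {O : Matrix (Fin d) (Fin d) ℂ} (hO : O.IsHermitian) (W : U d) :
    (heisenberg O W).IsHermitian := by
  rw [Matrix.IsHermitian, heisenberg, Matrix.conjTranspose_mul, Matrix.conjTranspose_mul,
    Matrix.conjTranspose_conjTranspose, hO.eq, Matrix.mul_assoc]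

lemma heisenberg_sub_smul_one (O : Matrix (Fin d) (Fin d) ℂ) (c : ℂ) (W : U d) :
    heisenberg (O - c • 1) W = heisenberg O W - c • 1 := by
  simp only [heisenberg, Matrix.mul_sub, Matrix.sub_mul, Matrix.mul_smul, Matrix.mul_one,
    Matrix.smul_mul, conjTranspose_mul_self_unitary]

/-- The part of a second-moment matrix which enters through the input state:
the expectation of `conj W_{j0} W_{j'0} W_{k0} conj W_{k'0}`. -/
noncomputable def stateMoment [NeZero d] (M : Matrix (Idx d × Idx d) (Idx d × Idx d) ℂ)
    (p q : Idx d) : ℂ := M ((p.2, q.1), (p.1, q.2)) ((0, 0), (0, 0))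

/-- The part of a second-moment matrix which enters through the observable:
the expectation of `(W† O W)_{jj'} (W† O W)_{k'k}`. -/
noncomputable def obsMoment (O : Matrix (Fin d) (Fin d) ℂ)
    (M : Matrix (Idx d × Idx d) (Idx d × Idx d) ℂ) (p q : Idx d) : ℂ :=
  ∑ u : Idx d × Idx d, (O ⊗ₖ O) u.2 u.1 * M u ((p.2, q.1), (p.1, q.2))

lemma stateMoment_sub [NeZero d] (M M' : Matrix (Idx d × Idx d) (Idx d × Idx d) ℂ)
    (p q : Idx d) : stateMoment (M - M') p q = stateMoment M p q - stateMoment M' p q := rfl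

lemma obsMoment_sub (O : Matrix (Fin d) (Fin d) ℂ) (M M' : Matrix (Idx d × Idx d) (Idx d × Idx d) ℂ)
    (p q : Idx d) : obsMoment O (M - M') p q = obsMoment O M p q - obsMoment O M' p q := by
  simp only [obsMoment, Matrix.sub_apply, mul_sub, Finset.sum_sub_distrib]

lemma stateMoment_momentMatrix [NeZero d] (W : U d) (p q : Idx d) :
    stateMoment (momentMatrix W) p q =
      (star ((W : Matrix (Fin d) (Fin d) ℂ) p.1 0) * (W : Matrix (Fin d) (Fin d) ℂ) p.2 0) *
        ((W : Matrix (Fin d) (Fin d) ℂ) q.1 0 * star ((W : Matrix (Fin d) (Fin d) ℂ) q.2 0)) := by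
  simp only [stateMoment, momentMatrix, Matrix.kroneckerMap_apply, Matrix.map_apply]
  ring

lemma obsMoment_momentMatrix (O : Matrix (Fin d) (Fin d) ℂ) (W : U d) (p q : Idx d) :
    obsMoment O (momentMatrix W) p q = heisenberg O W p.1 p.2 * heisenberg O W q.2 q.1 := by
  have h : ∀ i j, heisenberg O W i j = ∑ b, ∑ a, star ((W : Matrix (Fin d) (Fin d) ℂ) a i) * O a b *
      (W : Matrix (Fin d) (Fin d) ℂ) b j := by
    intro i j
    simp only [heisenberg, Matrix.mul_apply, Matrix.conjTranspose_apply, Finset.sum_mul]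
  simp only [h, obsMoment, momentMatrix, Matrix.kroneckerMap_apply, Matrix.map_apply,
    Fintype.sum_prod_type, Finset.sum_mul_sum]
  refine Finset.sum_congr rfl fun b _ => Finset.sum_congr rfl fun e _ =>
    Finset.sum_congr rfl fun a _ => Finset.sum_congr rfl fun c _ => ?_
  ring

section Random

variable {Ω : Type*} [MeasurableSpace Ω] {P : Measure Ω} {W : Ω → U d}

lemma continuous_momentMatrix (a b : Idx d × Idx d) :
    Continuous fun W : U d => momentMatrix W a b := by
  simp only [momentMatrix, Matrix.kroneckerMap_apply, Matrix.map_apply]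
  exact ((continuous_entry _ _).mul (continuous_entry _ _)).mul
    ((continuous_entry _ _).star.mul (continuous_entry _ _).star)

lemma stateMoment_secondMoment [NeZero d] (p q : Idx d) :
    stateMoment (secondMoment P W) p q = ∫ θ, stateMoment (momentMatrix (W θ)) p q ∂P := rfl

lemma obsMoment_secondMoment [IsFiniteMeasure P] (hW : Measurable W) (O : Matrix (Fin d) (Fin d) ℂ)
    (p q : Idx d) :
    obsMoment O (secondMoment P W) p q = ∫ θ, obsMoment O (momentMatrix (W θ)) p q ∂P := by
  simp only [obsMoment]
  rw [integral_finsetSum _ fun u _ =>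
    (integrable_comp hW (continuous_momentMatrix _ _)).const_mul _]
  refine Finset.sum_congr rfl fun u _ => ?_
  rw [integral_const_mul]
  rfl

lemma continuous_stateMoment [NeZero d] (p q : Idx d) :
    Continuous fun W : U d => stateMoment (momentMatrix W) p q := continuous_momentMatrix _ _

lemma continuous_obsMoment (O : Matrix (Fin d) (Fin d) ℂ) (p q : Idx d) :
    Continuous fun W : U d => obsMoment O (momentMatrix W) p q :=
  continuous_finsetSum _ fun _ _ => continuous_const.mul (continuous_momentMatrix _ _)

end Random

/-- Second moments of a column of a Haar unitary. -/
lemma stateMoment_haar [NeZero d] (hd : 2 ≤ d) (p q : Idx d) :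
    stateMoment (secondMoment (haarU d) id) p q =
      ((if p.1 = p.2 ∧ q.1 = q.2 then 1 else 0) + (if p = q then 1 else 0)) /
        ((d : ℂ) * (d + 1)) := by
  -- `W E W†` is the rank one projection onto the first column of `W`, so both trace constants equal
  -- `1`. Conjugation by `g` is left translation of `W`.
  set E : Matrix (Fin d) (Fin d) ℂ := Matrix.single 0 0 1
  set T : U d → Matrix (Fin d) (Fin d) ℂ := fun W =>
    (W : Matrix (Fin d) (Fin d) ℂ) * E * (W : Matrix (Fin d) (Fin d) ℂ).conjTranspose with hTdef
  have hcoe : Continuous fun W : U d => (W : Matrix (Fin d) (Fin d) ℂ) := continuous_subtype_val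
  have hT : Continuous T :=
    (hcoe.matrix_mul continuous_const).matrix_mul hcoe.matrix_conjTranspose
  have hTe : ∀ W i j, T W i j = (W : Matrix (Fin d) (Fin d) ℂ) i 0 *
      star ((W : Matrix (Fin d) (Fin d) ℂ) j 0) := by
    intro W i j
    simp [hTdef, Matrix.mul_apply, E, Matrix.single_apply, ite_and]
  have hTT : ∀ W, T W * T W = T W := by
    intro W
    have hE : E * E = E := by simp [E]
    simp only [hTdef, Matrix.mul_assoc]
    rw [← Matrix.mul_assoc (W : Matrix (Fin d) (Fin d) ℂ).conjTranspose
      (W : Matrix (Fin d) (Fin d) ℂ), conjTranspose_mul_self_unitary, Matrix.one_mul,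
      ← Matrix.mul_assoc E E, hE]
  have htr : ∀ W, (T W).trace = 1 := by
    intro W
    rw [hTdef]
    dsimp only
    rw [Matrix.mul_assoc, Matrix.trace_mul_comm, Matrix.mul_assoc, conjTranspose_mul_self_unitary,
      Matrix.mul_one]
    simp [E]
  have hinv : ∀ (g : U d) (r u : Idx d),
      ∫ W, (((g : Matrix (Fin d) (Fin d) ℂ) * T W * (g : Matrix (Fin d) (Fin d) ℂ).conjTranspose) ⊗ₖ
        ((g : Matrix (Fin d) (Fin d) ℂ) * T W * (g : Matrix (Fin d) (Fin d) ℂ).conjTranspose)) r u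
          ∂haarU d = ∫ W, (T W ⊗ₖ T W) r u ∂haarU d := by
    intro g r u
    rw [← integral_mul_left_eq_self (fun W => (T W ⊗ₖ T W) r u) g]
    have : ∀ W, (g : Matrix (Fin d) (Fin d) ℂ) * T W *
        (g : Matrix (Fin d) (Fin d) ℂ).conjTranspose = T (g * W) := by
      intro W
      simp only [hTdef, Submonoid.coe_mul, Matrix.conjTranspose_mul, Matrix.mul_assoc]
    simp only [this]
  have key := haar_integral_kronecker hd hT hinv htr (fun W => by rw [hTT, htr])
    (p.2, q.1) (p.1, q.2)
  rw [stateMoment_secondMoment]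
  have e : ∀ W : U d, stateMoment (momentMatrix (id W)) p q =
      (T W ⊗ₖ T W) (p.2, q.1) (p.1, q.2) := by
    intro W
    simp only [id, stateMoment_momentMatrix, Matrix.kroneckerMap_apply, hTe]
    ring
  simp only [e, key]
  have h1 : (p.2 = p.1 ∧ q.1 = q.2) ↔ (p.1 = p.2 ∧ q.1 = q.2) := by rw [eq_comm]
  have h2 : (p.2 = q.2 ∧ q.1 = p.1) ↔ p = q := by
    rw [Prod.ext_iff]
    exact ⟨fun h => ⟨h.2.symm, h.1⟩, fun h => ⟨h.2, h.1.symm⟩⟩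
  simp only [h1, h2]
  have hd0 : (d : ℂ) ≠ 0 := by
    have : d ≠ 0 := by omega
    exact_mod_cast this
  have hd1 : (d : ℂ) - 1 ≠ 0 := by
    have h2 : (d : ℝ) - 1 ≠ 0 := by
      have : (2 : ℝ) ≤ d := by exact_mod_cast hd
      linarith
    exact_mod_cast h2
  have hd2 : (d : ℂ) + 1 ≠ 0 := by exact_mod_cast Nat.succ_ne_zero d
  have hd3 : (d : ℂ) ^ 2 - 1 ≠ 0 := by
    rw [show (d : ℂ) ^ 2 - 1 = (d - 1) * (d + 1) by ring]
    exact mul_ne_zero hd1 hd2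
  field_simp
  ring

/-- Second moments of the Heisenberg observable of a Haar unitary. -/
lemma obsMoment_haar (hd : 2 ≤ d) {O : Matrix (Fin d) (Fin d) ℂ} (hO : O.trace = 0)
    (p q : Idx d) :
    obsMoment O (secondMoment (haarU d) id) p q =
      (O * O).trace / ((d : ℂ) ^ 2 - 1) *
        ((if p = q then 1 else 0) - (if p.1 = p.2 ∧ q.1 = q.2 then 1 else 0) / d) := by
  have hinv : ∀ (g : U d) (r u : Idx d),
      ∫ W, (((g : Matrix (Fin d) (Fin d) ℂ) * heisenberg O W *
        (g : Matrix (Fin d) (Fin d) ℂ).conjTranspose) ⊗ₖ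
        ((g : Matrix (Fin d) (Fin d) ℂ) * heisenberg O W *
          (g : Matrix (Fin d) (Fin d) ℂ).conjTranspose)) r u
          ∂haarU d = ∫ W, (heisenberg O W ⊗ₖ heisenberg O W) r u ∂haarU d := by
    intro g r u
    -- Conjugating `W† O W` by `g` replaces `W` by `W g⁻¹`, so right invariance is the relevant one
    -- here.
    rw [← integral_mul_right_eq_self (fun W => (heisenberg O W ⊗ₖ heisenberg O W) r u) g⁻¹]
    have : ∀ W, (g : Matrix (Fin d) (Fin d) ℂ) * heisenberg O W *
        (g : Matrix (Fin d) (Fin d) ℂ).conjTranspose = heisenberg O (W * g⁻¹) := by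
      intro W
      simp only [heisenberg, Submonoid.coe_mul, coe_inv_unitary, Matrix.conjTranspose_mul,
        Matrix.mul_assoc, Matrix.conjTranspose_conjTranspose]
    simp only [this]
  have key := haar_integral_kronecker hd (continuous_heisenberg O) hinv (trace_heisenberg O)
    (fun W => by rw [heisenberg_mul, trace_heisenberg]) (p.1, q.2) (p.2, q.1)
  rw [obsMoment_secondMoment measurable_id]
  have e : ∀ W : U d, obsMoment O (momentMatrix (id W)) p q =
      (heisenberg O W ⊗ₖ heisenberg O W) (p.1, q.2) (p.2, q.1) := by
    intro W
    rw [id, obsMoment_momentMatrix, Matrix.kroneckerMap_apply]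
  simp only [e, key, hO]
  have h1 : (p.1 = p.2 ∧ q.2 = q.1) ↔ (p.1 = p.2 ∧ q.1 = q.2) := by rw [eq_comm (a := q.2)]
  have h2 : (p.1 = q.1 ∧ q.2 = p.2) ↔ p = q := by
    rw [Prod.ext_iff, eq_comm (a := q.2)]
  simp only [h1, h2]
  ring

end Moments

/-! ### Variance of a Fourier coefficient and its expansion in second moments. -/

section Variance

variable {d : ℕ} {Ω : Type*} [MeasurableSpace Ω] {P : Measure Ω}

lemma cvar_eq [IsProbabilityMeasure P] {X : Ω → ℂ} (hX : Integrable X P)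
    (hX2 : Integrable (fun θ => ‖X θ‖ ^ 2) P) :
    cvar P X = ∫ θ, ‖X θ‖ ^ 2 ∂P - ‖∫ θ, X θ ∂P‖ ^ 2 := by
  set m := ∫ θ, X θ ∂P with hm
  have h1 : ∀ θ, ‖X θ - m‖ ^ 2 = ‖X θ‖ ^ 2 - 2 * (X θ * star m).re + ‖m‖ ^ 2 := by
    intro θ
    rw [← Complex.normSq_eq_norm_sq, ← Complex.normSq_eq_norm_sq, ← Complex.normSq_eq_norm_sq,
      Complex.normSq_sub, Complex.star_def]
    ring
  have h2 : Integrable (fun θ => (X θ * star m).re) P := (hX.mul_const _).re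
  have h3 : ∫ θ, (X θ * star m).re ∂P = ‖m‖ ^ 2 := by
    have h : ∫ θ, (X θ * star m).re ∂P = (∫ θ, X θ * star m ∂P).re :=
      integral_re (hX.mul_const (star m))
    rw [h, integral_mul_const, ← hm, Complex.star_def, Complex.mul_conj,
      Complex.normSq_eq_norm_sq, Complex.ofReal_re]
  have h4 : Integrable (fun θ => ‖X θ‖ ^ 2 - 2 * (X θ * star m).re) P :=
    hX2.sub (h2.const_mul 2)
  unfold cvar
  simp only [← hm, h1]
  rw [integral_add h4 (integrable_const _),
    integral_sub hX2 (h2.const_mul 2), integral_const_mul, h3]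
  simp
  ring

lemma cvar_sub_const [IsProbabilityMeasure P] {X : Ω → ℂ} (hX : Integrable X P) (c : ℂ) :
    cvar P (fun θ => X θ - c) = cvar P X := by
  unfold cvar
  rw [integral_sub hX (integrable_const _)]
  simp

/-- Every pair `(k, k)` has frequency `0`, so `R(ω)` contains the whole diagonal or none of it, even
when `lam` is degenerate. -/
lemma sum_generator_diag {A : Type*} [AddCommMonoid A] (lam : Fin d → ℝ) (ω : ℝ) (f : Idx d → A) :
    ∑ p ∈ generator lam ω, (if p.1 = p.2 then f p else 0) =
      if ω = 0 then ∑ k, f (k, k) else 0 := by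
  rw [generator, Finset.sum_filter, Fintype.sum_prod_type]
  have : ∀ i j, (if lam i - lam j = ω then (if i = j then f (i, j) else 0) else 0) =
      if i = j then (if ω = 0 then f (i, i) else 0) else 0 := by
    intro i j
    by_cases h : i = j
    · subst h
      simp [eq_comm]
    · simp [h]
  simp only [this, Finset.sum_ite_eq, Finset.mem_univ, if_true]
  split_ifs <;> simp

lemma sum_norm_column_sq [NeZero d] (V : U d) :
    ∑ k, star ((V : Matrix (Fin d) (Fin d) ℂ) k 0) * (V : Matrix (Fin d) (Fin d) ℂ) k 0 = 1 := by
  have := congrFun (congrFun (conjTranspose_mul_self_unitary V) 0) 0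
  simpa [Matrix.mul_apply] using this

lemma fourierCoeff_eq [NeZero d] (lam : Fin d → ℝ) (O : Matrix (Fin d) (Fin d) ℂ) (ω : ℝ)
    (V W : U d) : fourierCoeff lam O ω V W = ∑ p ∈ generator lam ω,
      (star ((V : Matrix (Fin d) (Fin d) ℂ) p.1 0) * (V : Matrix (Fin d) (Fin d) ℂ) p.2 0) *
        heisenberg O W p.1 p.2 := by
  refine Finset.sum_congr rfl fun p _ => ?_
  rw [heisenberg]
  ring

lemma fourierCoeff_sub_smul_one [NeZero d] (lam : Fin d → ℝ) (O : Matrix (Fin d) (Fin d) ℂ) (ω : ℝ)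
    (c : ℂ) (V W : U d) : fourierCoeff lam (O - c • 1) ω V W =
      fourierCoeff lam O ω V W - if ω = 0 then c else 0 := by
  have h := sum_generator_diag lam ω fun p =>
    star ((V : Matrix (Fin d) (Fin d) ℂ) p.1 0) * (V : Matrix (Fin d) (Fin d) ℂ) p.2 0 * c
  rw [← Finset.sum_mul, sum_norm_column_sq, one_mul] at h
  rw [fourierCoeff_eq, fourierCoeff_eq, ← h, ← Finset.sum_sub_distrib]
  refine Finset.sum_congr rfl fun p _ => ?_
  rw [heisenberg_sub_smul_one, Matrix.sub_apply, Matrix.smul_apply, Matrix.one_apply]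
  split_ifs
  · simp; ring
  · simp

/-- Hermiticity replaces the conjugate of the `(k, k')` entry of `W† O W` by its `(k', k)` entry,
whence the index order in `obsMoment`. Each summand factors into a function of `V` and a function of
`W`, as independence requires. -/
lemma norm_sq_fourierCoeff [NeZero d] (lam : Fin d → ℝ) {O : Matrix (Fin d) (Fin d) ℂ}
    (hO : O.IsHermitian) (ω : ℝ) (V W : U d) : ((‖fourierCoeff lam O ω V W‖ ^ 2 : ℝ) : ℂ) =
      ∑ p ∈ generator lam ω, ∑ q ∈ generator lam ω,
        stateMoment (momentMatrix V) p q * obsMoment O (momentMatrix W) p q := by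
  rw [Complex.ofReal_pow, ← Complex.mul_conj', fourierCoeff_eq, map_sum, Finset.sum_mul_sum]
  refine Finset.sum_congr rfl fun p _ => Finset.sum_congr rfl fun q _ => ?_
  rw [stateMoment_momentMatrix, obsMoment_momentMatrix,
    ← (heisenberg_isHermitian hO W).apply q.2 q.1]
  simp
  ring

section Independent

variable [IsProbabilityMeasure P] {W₁ W₂ : Ω → U d}

lemma integrable_mul_comp (h₁ : Measurable W₁) (h₂ : Measurable W₂) (hind : IndepFun W₁ W₂ P)
    {f g : U d → ℂ} (hf : Continuous f) (hg : Continuous g) :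
    Integrable (fun θ => f (W₁ θ) * g (W₂ θ)) P :=
  (hind.comp hf.measurable hg.measurable).integrable_mul (integrable_comp h₁ hf)
    (integrable_comp h₂ hg)

lemma integral_mul_comp (h₁ : Measurable W₁) (h₂ : Measurable W₂) (hind : IndepFun W₁ W₂ P)
    {f g : U d → ℂ} (hf : Continuous f) (hg : Continuous g) :
    ∫ θ, f (W₁ θ) * g (W₂ θ) ∂P = (∫ θ, f (W₁ θ) ∂P) * ∫ θ, g (W₂ θ) ∂P :=
  (hind.comp hf.measurable hg.measurable).integral_fun_mul_eq_mul_integral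
    (integrable_comp h₁ hf).aestronglyMeasurable (integrable_comp h₂ hg).aestronglyMeasurable

lemma continuous_density [NeZero d] (p : Idx d) : Continuous fun V : U d =>
    star ((V : Matrix (Fin d) (Fin d) ℂ) p.1 0) * (V : Matrix (Fin d) (Fin d) ℂ) p.2 0 :=
  (continuous_entry _ _).star.mul (continuous_entry _ _)

lemma continuous_heisenberg_entry (O : Matrix (Fin d) (Fin d) ℂ) (i j : Fin d) :
    Continuous fun W : U d => heisenberg O W i j := (continuous_heisenberg O).matrix_elem i j

lemma integrable_fourierCoeff [NeZero d] (h₁ : Measurable W₁) (h₂ : Measurable W₂) (hind : IndepFun W₁ W₂ P)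
    (lam : Fin d → ℝ) (O : Matrix (Fin d) (Fin d) ℂ) (ω : ℝ) :
    Integrable (fun θ => fourierCoeff lam O ω (W₁ θ) (W₂ θ)) P := by
  simp only [fourierCoeff_eq]
  exact integrable_finsetSum _ fun p _ => integrable_mul_comp h₁ h₂ hind (continuous_density p)
    (continuous_heisenberg_entry O _ _)

lemma integrable_norm_sq_fourierCoeff [NeZero d] (h₁ : Measurable W₁) (h₂ : Measurable W₂)
    (hind : IndepFun W₁ W₂ P) (lam : Fin d → ℝ) {O : Matrix (Fin d) (Fin d) ℂ}
    (hO : O.IsHermitian) (ω : ℝ) :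
    Integrable (fun θ => ‖fourierCoeff lam O ω (W₁ θ) (W₂ θ)‖ ^ 2) P := by
  have h : Integrable (fun θ => ((‖fourierCoeff lam O ω (W₁ θ) (W₂ θ)‖ ^ 2 : ℝ) : ℂ)) P := by
    simp only [norm_sq_fourierCoeff lam hO]
    exact integrable_finsetSum _ fun p _ => integrable_finsetSum _ fun q _ =>
      integrable_mul_comp h₁ h₂ hind (continuous_stateMoment p q) (continuous_obsMoment O p q)
  simpa only [RCLike.re_to_complex, Complex.ofReal_re] using h.re

lemma integral_norm_sq_fourierCoeff [NeZero d] (h₁ : Measurable W₁) (h₂ : Measurable W₂)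
    (hind : IndepFun W₁ W₂ P) (lam : Fin d → ℝ) {O : Matrix (Fin d) (Fin d) ℂ}
    (hO : O.IsHermitian) (ω : ℝ) :
    ((∫ θ, ‖fourierCoeff lam O ω (W₁ θ) (W₂ θ)‖ ^ 2 ∂P : ℝ) : ℂ) =
      ∑ p ∈ generator lam ω, ∑ q ∈ generator lam ω,
        stateMoment (secondMoment P W₁) p q * obsMoment O (secondMoment P W₂) p q := by
  have hre : ((∫ θ, ‖fourierCoeff lam O ω (W₁ θ) (W₂ θ)‖ ^ 2 ∂P : ℝ) : ℂ) =
      ∫ θ, ((‖fourierCoeff lam O ω (W₁ θ) (W₂ θ)‖ ^ 2 : ℝ) : ℂ) ∂P :=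
    (integral_ofReal (𝕜 := ℂ)).symm
  rw [hre]
  have hint := fun p q => integrable_mul_comp h₁ h₂ hind (continuous_stateMoment p q)
    (continuous_obsMoment O p q)
  simp only [norm_sq_fourierCoeff lam hO, obsMoment_secondMoment h₂,
    stateMoment_secondMoment]
  rw [integral_finsetSum _ fun p _ => integrable_finsetSum _ fun q _ => hint p q]
  refine Finset.sum_congr rfl fun p _ => ?_
  rw [integral_finsetSum _ fun q _ => hint p q]
  exact Finset.sum_congr rfl fun q _ => integral_mul_comp h₁ h₂ hind (continuous_stateMoment p q)
    (continuous_obsMoment O p q)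

lemma integral_fourierCoeff [NeZero d] (h₁ : Measurable W₁) (h₂ : Measurable W₂)
    (hind : IndepFun W₁ W₂ P) (lam : Fin d → ℝ) (O : Matrix (Fin d) (Fin d) ℂ) (ω : ℝ) :
    ∫ θ, fourierCoeff lam O ω (W₁ θ) (W₂ θ) ∂P = ∑ p ∈ generator lam ω,
      (∫ θ, star ((W₁ θ : Matrix (Fin d) (Fin d) ℂ) p.1 0) *
        (W₁ θ : Matrix (Fin d) (Fin d) ℂ) p.2 0 ∂P) * ∫ θ, heisenberg O (W₂ θ) p.1 p.2 ∂P := by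
  simp only [fourierCoeff_eq]
  rw [integral_finsetSum _ fun p _ => integrable_mul_comp h₁ h₂ hind (continuous_density p)
    (continuous_heisenberg_entry O _ _)]
  exact Finset.sum_congr rfl fun p _ => integral_mul_comp h₁ h₂ hind (continuous_density p)
    (continuous_heisenberg_entry O _ _)

end Independent

/-! ### Linear functionals of second moments -/

/-- `stateMoment` as a linear functional. -/
noncomputable def stateMomentLinear [NeZero d] (p q : Idx d) :
    Matrix (Idx d × Idx d) (Idx d × Idx d) ℂ →ₗ[ℂ] ℂ where
  toFun M := stateMoment M p q
  map_add' _ _ := rfl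
  map_smul' _ _ := rfl

/-- `obsMoment` as a linear functional. -/
noncomputable def obsMomentLinear (O : Matrix (Fin d) (Fin d) ℂ) (p q : Idx d) :
    Matrix (Idx d × Idx d) (Idx d × Idx d) ℂ →ₗ[ℂ] ℂ where
  toFun M := obsMoment O M p q
  map_add' _ _ := by simp only [obsMoment, Matrix.add_apply, mul_add, Finset.sum_add_distrib]
  map_smul' c _ := by
    simp only [obsMoment, Matrix.smul_apply, smul_eq_mul, Finset.mul_sum, RingHom.id_apply]
    exact Finset.sum_congr rfl fun _ _ => by ring

/-- Through this, identities valid for each single unitary pass to the averaged second moments. -/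
lemma linear_secondMoment [IsFiniteMeasure P] {W : Ω → U d} (hW : Measurable W)
    (L : Matrix (Idx d × Idx d) (Idx d × Idx d) ℂ →ₗ[ℂ] ℂ) :
    L (secondMoment P W) = ∫ θ, L (momentMatrix (W θ)) ∂P := by
  have hL : ∀ M, L M = ∑ a, ∑ b, M a b * L (Matrix.single a b 1) := by
    intro M
    conv_lhs => rw [Matrix.matrix_eq_sum_single M]
    simp only [map_sum]
    refine Finset.sum_congr rfl fun a _ => Finset.sum_congr rfl fun b _ => ?_
    rw [← smul_eq_mul, ← map_smul, Matrix.smul_single, smul_eq_mul, mul_one]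
  have hint := fun a b => (integrable_comp (P := P) hW (continuous_momentMatrix a b)).mul_const
    (L (Matrix.single a b 1))
  rw [hL]
  simp only [hL (momentMatrix _)]
  rw [integral_finsetSum _ fun a _ => integrable_finsetSum _ fun b _ => hint a b]
  refine Finset.sum_congr rfl fun a _ => ?_
  rw [integral_finsetSum _ fun b _ => hint a b]
  refine Finset.sum_congr rfl fun b _ => ?_
  rw [integral_mul_const]
  rfl

/-- Functionals which are constant on unitaries vanish on the deviation from a 2-design. -/
lemma linear_deviation_eq_zero [IsProbabilityMeasure P] {W : Ω → U d} (hW : Measurable W)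
    (L : Matrix (Idx d × Idx d) (Idx d × Idx d) ℂ →ₗ[ℂ] ℂ) (c : ℂ)
    (h : ∀ V : U d, L (momentMatrix V) = c) : L (deviation P W) = 0 := by
  rw [deviation, map_sub, linear_secondMoment measurable_id, linear_secondMoment hW]
  simp [h]

section Deviation

variable [IsProbabilityMeasure P] {W : Ω → U d}

/-- For `ω = 0` the sum evaluates on a unitary to the squared norm of its first column, squared,
which is always `1`; for other `ω` it is empty. -/
lemma sum_diag_stateMoment_deviation [NeZero d] (hW : Measurable W) (lam : Fin d → ℝ) (ω : ℝ) :
    ∑ p ∈ generator lam ω, ∑ q ∈ generator lam ω,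
      (if p.1 = p.2 then if q.1 = q.2 then stateMoment (deviation P W) p q else 0 else 0) = 0 := by
  have hsum : ∀ M, ∑ p ∈ generator lam ω, ∑ q ∈ generator lam ω,
      (if p.1 = p.2 then if q.1 = q.2 then stateMoment M p q else 0 else 0) =
      if ω = 0 then (∑ k, ∑ l, stateMomentLinear (d := d) (k, k) (l, l)) M else 0 := by
    intro M
    have : ∀ p : Idx d, ∑ q ∈ generator lam ω,
      (if p.1 = p.2 then if q.1 = q.2 then stateMoment M p q else 0 else 0) =
        if p.1 = p.2 then (if ω = 0 then ∑ l, stateMoment M p (l, l) else 0) else 0 := by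
      intro p
      rw [← sum_generator_diag lam ω fun q => stateMoment M p q]
      split_ifs <;> simp
    simp only [this, sum_generator_diag lam ω fun p =>
      (if ω = 0 then ∑ l, stateMoment M p (l, l) else 0)]
    split_ifs
    · simp only [LinearMap.sum_apply]
      rfl
    · rfl
  rw [hsum]
  split_ifs
  · refine linear_deviation_eq_zero hW _ 1 fun V => ?_
    have h1 := sum_norm_column_sq V
    have : ∀ k l, stateMomentLinear (k, k) (l, l) (momentMatrix V) =
        (star ((V : Matrix (Fin d) (Fin d) ℂ) k 0) * (V : Matrix (Fin d) (Fin d) ℂ) k 0) *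
        (star ((V : Matrix (Fin d) (Fin d) ℂ) l 0) * (V : Matrix (Fin d) (Fin d) ℂ) l 0) := by
      intro k l
      refine (stateMoment_momentMatrix V (k, k) (l, l)).trans ?_
      ring
    simp only [LinearMap.sum_apply, this]
    rw [← Finset.sum_mul_sum, h1, one_mul]
  · rfl

/-- On each unitary the sum is `Tr(W† O W)² = Tr(O)²` for `ω = 0`, and empty otherwise. -/
lemma sum_diag_obsMoment_deviation (hW : Measurable W) (O : Matrix (Fin d) (Fin d) ℂ)
    (lam : Fin d → ℝ) (ω : ℝ) :
    ∑ p ∈ generator lam ω, ∑ q ∈ generator lam ω,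
      (if p.1 = p.2 then if q.1 = q.2 then obsMoment O (deviation P W) p q else 0 else 0) = 0 := by
  have hsum : ∀ M, ∑ p ∈ generator lam ω, ∑ q ∈ generator lam ω,
      (if p.1 = p.2 then if q.1 = q.2 then obsMoment O M p q else 0 else 0) =
      if ω = 0 then (∑ k, ∑ l, obsMomentLinear O (k, k) (l, l)) M else 0 := by
    intro M
    have : ∀ p : Idx d, ∑ q ∈ generator lam ω,
      (if p.1 = p.2 then if q.1 = q.2 then obsMoment O M p q else 0 else 0) =
        if p.1 = p.2 then (if ω = 0 then ∑ l, obsMoment O M p (l, l) else 0) else 0 := by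
      intro p
      rw [← sum_generator_diag lam ω fun q => obsMoment O M p q]
      split_ifs <;> simp
    simp only [this, sum_generator_diag lam ω fun p =>
      (if ω = 0 then ∑ l, obsMoment O M p (l, l) else 0)]
    split_ifs
    · simp only [LinearMap.sum_apply]
      rfl
    · rfl
  rw [hsum]
  split_ifs
  · refine linear_deviation_eq_zero hW _ (O.trace * O.trace) fun V => ?_
    have : ∀ k l, obsMomentLinear O (k, k) (l, l) (momentMatrix V) =
        heisenberg O V k k * heisenberg O V l l := fun k l =>
      obsMoment_momentMatrix O V (k, k) (l, l)
    simp only [LinearMap.sum_apply, this]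
    rw [← Finset.sum_mul_sum]
    change (heisenberg O V).trace * (heisenberg O V).trace = _
    rw [trace_heisenberg]
  · rfl

/-- The sum of the diagonal observable moments does not see a shift of the observable. -/
lemma sum_obsMoment_deviation_sub_smul_one (hW : Measurable W) (O : Matrix (Fin d) (Fin d) ℂ)
    (c : ℂ) (lam : Fin d → ℝ) (ω : ℝ) :
    ∑ p ∈ generator lam ω, obsMoment (O - c • 1) (deviation P W) p p =
      ∑ p ∈ generator lam ω, obsMoment O (deviation P W) p p := by
  rw [← sub_eq_zero]
  set L : Matrix (Idx d × Idx d) (Idx d × Idx d) ℂ →ₗ[ℂ] ℂ :=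
    ∑ p ∈ generator lam ω, obsMomentLinear (O - c • 1) p p -
      ∑ p ∈ generator lam ω, obsMomentLinear O p p with hL
  have hLM : ∀ M, L M = ∑ p ∈ generator lam ω, obsMoment (O - c • 1) M p p -
      ∑ p ∈ generator lam ω, obsMoment O M p p := by
    intro M
    simp only [hL, LinearMap.sub_apply, LinearMap.sum_apply]
    rfl
  rw [← hLM]
  -- Only diagonal pairs feel the shift, each by `c² - 2c (V† O V)_{kk}`; summed over `k` this
  -- depends on `V` only through the trace.
  refine linear_deviation_eq_zero hW L
    (if ω = 0 then d * c ^ 2 - 2 * c * O.trace else 0) fun V => ?_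
  rw [hLM, ← Finset.sum_sub_distrib]
  have h1 : ∀ p : Idx d, obsMoment (O - c • 1) (momentMatrix V) p p - obsMoment O (momentMatrix V) p p
      = if p.1 = p.2 then c ^ 2 - 2 * c * heisenberg O V p.1 p.1 else 0 := by
    intro p
    rw [obsMoment_momentMatrix, obsMoment_momentMatrix, heisenberg_sub_smul_one]
    simp only [Matrix.sub_apply, Matrix.smul_apply, Matrix.one_apply, smul_eq_mul]
    by_cases h : p.1 = p.2
    · rw [h]; simp; ring
    · simp [h, Ne.symm h]
  simp only [h1, sum_generator_diag lam ω fun p => c ^ 2 - 2 * c * heisenberg O V p.1 p.1]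
  congr 1
  rw [Finset.sum_sub_distrib, ← Finset.mul_sum, ← trace_heisenberg O V]
  simp [Matrix.trace]

/-- Centering the observable centers the matrix of its moments on both sides. -/
lemma obsMoment_deviation_centered [NeZero d] (hW : Measurable W) (O : Matrix (Fin d) (Fin d) ℂ)
    (p q : Idx d) :
    obsMoment (O - (O.trace / d) • 1) (deviation P W) p q =
      (obsMoment O (deviation P W) p q -
        if p.1 = p.2 then (∑ k, obsMoment O (deviation P W) (k, k) q) / d else 0) -
      if q.1 = q.2 then (∑ l, (obsMoment O (deviation P W) p (l, l) -
        if p.1 = p.2 then (∑ k, obsMoment O (deviation P W) (k, k) (l, l)) / d else 0)) / d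
      else 0 := by
  rw [← sub_eq_zero]
  set a : ℂ := (if p.1 = p.2 then 1 else 0) / d with ha
  set b : ℂ := (if q.1 = q.2 then 1 else 0) / d with hb
  set L : Matrix (Idx d × Idx d) (Idx d × Idx d) ℂ →ₗ[ℂ] ℂ :=
    obsMomentLinear (O - (O.trace / d) • 1) p q - (obsMomentLinear O p q -
      a • ∑ k, obsMomentLinear O (k, k) q -
      b • ∑ l, (obsMomentLinear O p (l, l) - a • ∑ k, obsMomentLinear O (k, k) (l, l))) with hL
  have hLM : ∀ M, L M = obsMoment (O - (O.trace / d) • 1) M p q -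
      ((obsMoment O M p q - if p.1 = p.2 then (∑ k, obsMoment O M (k, k) q) / d else 0) -
      if q.1 = q.2 then (∑ l, (obsMoment O M p (l, l) -
        if p.1 = p.2 then (∑ k, obsMoment O M (k, k) (l, l)) / d else 0)) / d
      else 0) := by
    intro M
    simp only [hL, LinearMap.sub_apply, LinearMap.sum_apply, LinearMap.smul_apply, smul_eq_mul]
    have e : ∀ O p q, obsMomentLinear O p q M = obsMoment O M p q := fun _ _ _ => rfl
    simp only [e, ha, hb]
    split_ifs <;> simp [div_eq_inv_mul]
  rw [← hLM]
  -- On a single unitary both sides are the product of two centered entries, because `∑ (V† O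
  -- V)_{kk} = Tr O`; hence the constant `0`.
  refine linear_deviation_eq_zero hW L 0 fun V => ?_
  rw [hLM]
  have hd : (d : ℂ) ≠ 0 := by exact_mod_cast NeZero.ne d
  have ht := trace_heisenberg O V
  rw [Matrix.trace] at ht
  simp only [Matrix.diag] at ht
  simp only [obsMoment_momentMatrix, heisenberg_sub_smul_one, Matrix.sub_apply, Matrix.smul_apply,
    Matrix.one_apply, smul_eq_mul, ← Finset.sum_mul, ht, Finset.sum_sub_distrib, ← Finset.mul_sum]
  by_cases h1 : p.1 = p.2 <;> by_cases h2 : q.1 = q.2 <;>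
    simp [h1, h2, eq_comm (a := q.2), ← Finset.sum_div, ← Finset.mul_sum, ht] <;> field_simp <;> ring

/-- Removing the component along the diagonal is a contraction. -/
lemma sum_norm_sq_sub_diag_le [NeZero d] (lam : Fin d → ℝ) (ω : ℝ) (f : Idx d → ℂ) :
    ∑ p ∈ generator lam ω, ‖f p - if p.1 = p.2 then (∑ k, f (k, k)) / d else 0‖ ^ 2 ≤
      ∑ p ∈ generator lam ω, ‖f p‖ ^ 2 := by
  set m : ℂ := (∑ k, f (k, k)) / d with hm
  have hd : (d : ℂ) ≠ 0 := by exact_mod_cast NeZero.ne d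
  have h1 : ∀ p : Idx d, ‖f p - if p.1 = p.2 then m else 0‖ ^ 2 =
      ‖f p‖ ^ 2 - if p.1 = p.2 then 2 * (f p * star m).re - ‖m‖ ^ 2 else 0 := by
    intro p
    split_ifs
    · rw [← Complex.normSq_eq_norm_sq, ← Complex.normSq_eq_norm_sq, ← Complex.normSq_eq_norm_sq,
        Complex.normSq_sub, Complex.star_def]
      ring
    · simp
  simp only [h1]
  rw [Finset.sum_sub_distrib, sum_generator_diag lam ω fun p => 2 * (f p * star m).re - ‖m‖ ^ 2]
  -- As `m` is the diagonal mean, this sum is `2d‖m‖² - d‖m‖² = d‖m‖²`.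
  have h2 : 0 ≤ if ω = 0 then ∑ k, (2 * (f (k, k) * star m).re - ‖m‖ ^ 2) else 0 := by
    split_ifs
    · rw [Finset.sum_sub_distrib, ← Finset.mul_sum, ← Complex.re_sum, ← Finset.sum_mul]
      have h3 : ∑ k, f (k, k) = d * m := by rw [hm]; field_simp
      have h4 : (d * m * star m).re = d * ‖m‖ ^ 2 := by
        rw [mul_assoc, Complex.star_def, Complex.mul_conj, Complex.normSq_eq_norm_sq]
        norm_cast
      rw [h3, h4]
      simp only [Finset.sum_const, Finset.card_univ, Fintype.card_fin, nsmul_eq_mul]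
      have : 0 ≤ (d : ℝ) * ‖m‖ ^ 2 := by positivity
      linarith
    · exact le_rfl
  linarith

/-- Centering removes the diagonal mean in each of the two pair indices, a contraction in each.
Bounds on the deviation-deviation term can thus be stated with `O` itself. -/
lemma sum_norm_sq_obsMoment_centered_le [NeZero d] (hW : Measurable W)
    (O : Matrix (Fin d) (Fin d) ℂ) (lam : Fin d → ℝ) (ω : ℝ) :
    ∑ p ∈ generator lam ω, ∑ q ∈ generator lam ω,
      ‖obsMoment (O - (O.trace / d) • 1) (deviation P W) p q‖ ^ 2 ≤
    ∑ p ∈ generator lam ω, ∑ q ∈ generator lam ω, ‖obsMoment O (deviation P W) p q‖ ^ 2 := by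
  simp only [obsMoment_deviation_centered hW]
  refine (Finset.sum_le_sum fun p _ => sum_norm_sq_sub_diag_le lam ω fun q =>
    obsMoment O (deviation P W) p q -
        if p.1 = p.2 then (∑ k, obsMoment O (deviation P W) (k, k) q) / d else 0).trans ?_
  rw [Finset.sum_comm]
  conv_rhs => rw [Finset.sum_comm]
  exact Finset.sum_le_sum fun q _ => sum_norm_sq_sub_diag_le lam ω fun p =>
    obsMoment O (deviation P W) p q

end Deviation

end Variance

/-! ### The traceless part of the observable and the constant `C₁`. -/

section Centering

variable {d : ℕ}

/-- The traceless part of an observable. -/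
noncomputable def centered (O : Matrix (Fin d) (Fin d) ℂ) : Matrix (Fin d) (Fin d) ℂ :=
  O - (O.trace / d) • 1

lemma trace_centered [NeZero d] (O : Matrix (Fin d) (Fin d) ℂ) : (centered O).trace = 0 := by
  have hd : (d : ℂ) ≠ 0 := by exact_mod_cast NeZero.ne d
  rw [centered, Matrix.trace_sub, Matrix.trace_smul, Matrix.trace_one, Fintype.card_fin,
    smul_eq_mul, div_mul_cancel₀ _ hd, sub_self]

lemma star_trace {O : Matrix (Fin d) (Fin d) ℂ} (hO : O.IsHermitian) : star O.trace = O.trace := by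
  rw [← Matrix.trace_conjTranspose, hO.eq]

lemma trace_eq_re {O : Matrix (Fin d) (Fin d) ℂ} (hO : O.IsHermitian) :
    O.trace = (O.trace.re : ℂ) := (Complex.conj_eq_iff_re.1 (star_trace hO)).symm

lemma centered_isHermitian {O : Matrix (Fin d) (Fin d) ℂ} (hO : O.IsHermitian) :
    (centered O).IsHermitian := by
  rw [Matrix.IsHermitian, centered, Matrix.conjTranspose_sub, hO.eq, Matrix.conjTranspose_smul,
    Matrix.conjTranspose_one, star_div₀, star_trace hO]
  simp

lemma trace_mul_self_eq {O : Matrix (Fin d) (Fin d) ℂ} (hO : O.IsHermitian) :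
    (O * O).trace = ((∑ i, ∑ j, ‖O i j‖ ^ 2 : ℝ) : ℂ) := by
  simp only [Matrix.trace, Matrix.diag, Matrix.mul_apply]
  push_cast
  refine Finset.sum_congr rfl fun i _ => Finset.sum_congr rfl fun j _ => ?_
  rw [← hO.apply j i]
  exact Complex.mul_conj' _

lemma sum_norm_sq_centered [NeZero d] {O : Matrix (Fin d) (Fin d) ℂ} (hO : O.IsHermitian) :
    ∑ i, ∑ j, ‖centered O i j‖ ^ 2 = ∑ i, ∑ j, ‖O i j‖ ^ 2 - O.trace.re ^ 2 / d := by
  have hd : (d : ℂ) ≠ 0 := by exact_mod_cast NeZero.ne d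
  have h : (centered O * centered O).trace = (O * O).trace - O.trace ^ 2 / d := by
    rw [centered]
    simp only [Matrix.mul_sub, Matrix.sub_mul, Matrix.mul_smul, Matrix.smul_mul, Matrix.mul_one,
      Matrix.one_mul, Matrix.trace_sub, Matrix.trace_smul, Matrix.trace_one, Fintype.card_fin,
      smul_eq_mul]
    field_simp
    ring
  rw [trace_mul_self_eq hO, trace_mul_self_eq (centered_isHermitian hO), trace_eq_re hO] at h
  exact_mod_cast h

/-- In this form `C₁` is the coefficient appearing in `obsMoment_haar`, and its sign is evident. -/
lemma C₁_eq [NeZero d] (hd : 2 ≤ d) {O : Matrix (Fin d) (Fin d) ℂ} (hO : O.IsHermitian) :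
    C₁ O = (∑ i, ∑ j, ‖centered O i j‖ ^ 2) / ((d : ℝ) ^ 2 - 1) := by
  have h2 : (2 : ℝ) ≤ d := by exact_mod_cast hd
  have h0 : (d : ℝ) ≠ 0 := by linarith
  have h1 : (d : ℝ) ^ 2 - 1 ≠ 0 := by nlinarith
  rw [sum_norm_sq_centered hO, C₁, schattenNorm_two_sq]
  field_simp

lemma C₁_nonneg [NeZero d] (hd : 2 ≤ d) {O : Matrix (Fin d) (Fin d) ℂ} (hO : O.IsHermitian) :
    0 ≤ C₁ O := by
  have h2 : (2 : ℝ) ≤ d := by exact_mod_cast hd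
  rw [C₁_eq hd hO]
  refine div_nonneg (Finset.sum_nonneg fun _ _ => Finset.sum_nonneg fun _ _ => sq_nonneg _) ?_
  nlinarith

lemma sum_norm_sq_centered_le [NeZero d] {O : Matrix (Fin d) (Fin d) ℂ} (hO : O.IsHermitian) :
    ∑ i, ∑ j, ‖centered O i j‖ ^ 2 ≤ ∑ i, ∑ j, ‖O i j‖ ^ 2 := by
  rw [sum_norm_sq_centered hO]
  have : 0 ≤ O.trace.re ^ 2 / d := by positivity
  linarith

end Centering

/-! ### The four terms of the variance: Haar part and deviations. -/

section SecondMoment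

variable {d : ℕ}

lemma sum_ite_eq_generator (lam : Fin d → ℝ) (ω : ℝ) (f : Idx d → Idx d → ℂ) :
    ∑ p ∈ generator lam ω, ∑ q ∈ generator lam ω, (if p = q then f p q else 0) =
      ∑ p ∈ generator lam ω, f p p :=
  Finset.sum_congr rfl fun p hp => by rw [Finset.sum_ite_eq, if_pos hp]


lemma secondMoment_prod_fst {μ ν : Measure (U d)} [IsProbabilityMeasure μ]
    [IsProbabilityMeasure ν] : secondMoment (μ.prod ν) Prod.fst = secondMoment μ id := by
  ext a b
  change ∫ θ : U d × U d, momentMatrix θ.1 a b ∂(μ.prod ν) = ∫ V, momentMatrix V a b ∂μ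
  conv_rhs => rw [← (measurePreserving_fst (μ := μ) (ν := ν)).map_eq]
  exact (integral_map measurable_fst.aemeasurable
    (continuous_momentMatrix a b).measurable.aestronglyMeasurable).symm

lemma secondMoment_prod_snd {μ ν : Measure (U d)} [IsProbabilityMeasure μ]
    [IsProbabilityMeasure ν] : secondMoment (μ.prod ν) Prod.snd = secondMoment ν id := by
  ext a b
  change ∫ θ : U d × U d, momentMatrix θ.2 a b ∂(μ.prod ν) = ∫ V, momentMatrix V a b ∂ν
  conv_rhs => rw [← (measurePreserving_snd (μ := μ) (ν := ν)).map_eq]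
  exact (integral_map measurable_snd.aemeasurable
    (continuous_momentMatrix a b).measurable.aestronglyMeasurable).symm

variable [NeZero d]

/-- `E |c_ω|²` in terms of the second moments of the two unitaries. -/
noncomputable def coeffMoment (lam : Fin d → ℝ) (O : Matrix (Fin d) (Fin d) ℂ) (ω : ℝ)
    (M M' : Matrix (Idx d × Idx d) (Idx d × Idx d) ℂ) : ℂ :=
  ∑ p ∈ generator lam ω, ∑ q ∈ generator lam ω, stateMoment M p q * obsMoment O M' p q

lemma coeffMoment_sub_sub (lam : Fin d → ℝ) (O : Matrix (Fin d) (Fin d) ℂ) (ω : ℝ)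
    (M A M' A' : Matrix (Idx d × Idx d) (Idx d × Idx d) ℂ) :
    coeffMoment lam O ω (M - A) (M' - A') = coeffMoment lam O ω M M' - coeffMoment lam O ω A M' -
      coeffMoment lam O ω M A' + coeffMoment lam O ω A A' := by
  simp only [coeffMoment, stateMoment_sub, obsMoment_sub, ← Finset.sum_sub_distrib,
    ← Finset.sum_add_distrib]
  refine Finset.sum_congr rfl fun p _ => Finset.sum_congr rfl fun q _ => ?_
  ring

section Haar

lemma obsMoment_centered_haar (hd : 2 ≤ d) {O : Matrix (Fin d) (Fin d) ℂ}
    (hO : O.IsHermitian) (p q : Idx d) :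
    obsMoment (centered O) (secondMoment (haarU d) id) p q =
      (C₁ O : ℂ) * ((if p = q then 1 else 0) -
        (if p.1 = p.2 then if q.1 = q.2 then 1 else 0 else 0) / d) := by
  rw [obsMoment_haar hd (trace_centered O), trace_mul_self_eq (centered_isHermitian hO),
    C₁_eq hd hO]
  push_cast
  simp only [ite_and]

/-- Of the two parts of the Haar observable moment, `δ_{p,q}` leaves the diagonal sum, and the trace
part dies by `sum_diag_stateMoment_deviation`. -/
lemma coeffMoment_deviation_haar (hd : 2 ≤ d) {O : Matrix (Fin d) (Fin d) ℂ}
    (hO : O.IsHermitian) (lam : Fin d → ℝ) (ω : ℝ)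
    {Ω : Type*} [MeasurableSpace Ω] {P : Measure Ω}
    [IsProbabilityMeasure P] {W : Ω → U d} (hW : Measurable W) :
    coeffMoment lam (centered O) ω (deviation P W) (secondMoment (haarU d) id) =
      C₁ O * ∑ p ∈ generator lam ω, stateMoment (deviation P W) p p := by
  have h0 := sum_diag_stateMoment_deviation (P := P) hW lam ω
  have key : coeffMoment lam (centered O) ω (deviation P W) (secondMoment (haarU d) id) =
      C₁ O * (∑ p ∈ generator lam ω, ∑ q ∈ generator lam ω,
        (if p = q then stateMoment (deviation P W) p q else 0) -
      (∑ p ∈ generator lam ω, ∑ q ∈ generator lam ω,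
        (if p.1 = p.2 then if q.1 = q.2 then stateMoment (deviation P W) p q else 0 else 0)) / d) := by
    simp only [coeffMoment, obsMoment_centered_haar hd hO, Finset.sum_div, Finset.mul_sum,
      ← Finset.sum_sub_distrib]
    refine Finset.sum_congr rfl fun p _ => Finset.sum_congr rfl fun q _ => ?_
    split_ifs <;> ring
  rw [key, h0, sum_ite_eq_generator, zero_div, sub_zero]

/-- The trace part dies as in the other mixed term. The remaining diagonal sum is blind to
centering, so `O` replaces its traceless part. -/
lemma coeffMoment_haar_deviation (hd : 2 ≤ d) (O : Matrix (Fin d) (Fin d) ℂ)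
    (lam : Fin d → ℝ) (ω : ℝ) {Ω : Type*} [MeasurableSpace Ω] {P : Measure Ω}
    [IsProbabilityMeasure P] {W : Ω → U d} (hW : Measurable W) :
    coeffMoment lam (centered O) ω (secondMoment (haarU d) id) (deviation P W) =
      (∑ p ∈ generator lam ω, obsMoment O (deviation P W) p p) / ((d : ℂ) * (d + 1)) := by
  have h0 := sum_diag_obsMoment_deviation (P := P) hW (centered O) lam ω
  have h1 := sum_obsMoment_deviation_sub_smul_one (P := P) hW O (O.trace / d) lam ω
  rw [← centered] at h1
  have key : coeffMoment lam (centered O) ω (secondMoment (haarU d) id) (deviation P W) =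
      (∑ p ∈ generator lam ω, ∑ q ∈ generator lam ω,
        (if p = q then obsMoment (centered O) (deviation P W) p q else 0) +
      ∑ p ∈ generator lam ω, ∑ q ∈ generator lam ω,
        (if p.1 = p.2 then if q.1 = q.2 then obsMoment (centered O) (deviation P W) p q else 0
          else 0)) / ((d : ℂ) * (d + 1)) := by
    simp only [coeffMoment, stateMoment_haar hd, Finset.sum_div, ← Finset.sum_add_distrib]
    refine Finset.sum_congr rfl fun p _ => Finset.sum_congr rfl fun q _ => ?_
    simp only [ite_and]
    split_ifs <;> ring
  rw [key, h0, sum_ite_eq_generator, add_zero, h1]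

lemma coeffMoment_haar_haar (hd : 2 ≤ d) {O : Matrix (Fin d) (Fin d) ℂ}
    (hO : O.IsHermitian) (lam : Fin d → ℝ) (ω : ℝ) :
    coeffMoment lam (centered O) ω (secondMoment (haarU d) id) (secondMoment (haarU d) id) =
      C₁ O / ((d : ℂ) * (d + 1)) * ((generator lam ω).card - if ω = 0 then 1 else 0) := by
  have hd0 : (d : ℂ) ≠ 0 := by exact_mod_cast NeZero.ne d
  have s1 : ∑ p ∈ generator lam ω, ∑ q ∈ generator lam ω, (if p = q then (1 : ℂ) else 0) =
      (generator lam ω).card := by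
    rw [sum_ite_eq_generator lam ω fun _ _ => 1]; simp
  have s2 : ∑ p ∈ generator lam ω, ∑ q ∈ generator lam ω,
      (if p = q then (if p.1 = p.2 then (1 : ℂ) else 0) else 0) = if ω = 0 then (d : ℂ) else 0 := by
    rw [sum_ite_eq_generator lam ω fun p _ => if p.1 = p.2 then (1 : ℂ) else 0,
      sum_generator_diag lam ω fun _ => (1 : ℂ)]
    simp
  have s3 : ∑ p ∈ generator lam ω, ∑ q ∈ generator lam ω,
      (if p.1 = p.2 then if q.1 = q.2 then (1 : ℂ) else 0 else 0) =
        if ω = 0 then (d : ℂ) ^ 2 else 0 := by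
    have : ∀ p : Idx d, ∑ q ∈ generator lam ω,
        (if p.1 = p.2 then if q.1 = q.2 then (1 : ℂ) else 0 else 0) =
        if p.1 = p.2 then (if ω = 0 then (d : ℂ) else 0) else 0 := by
      intro p
      have := sum_generator_diag lam ω fun _ => (1 : ℂ)
      split_ifs with h
      · simp_all
      · simp_all
      · simp
    simp only [this, sum_generator_diag lam ω fun _ => (if ω = 0 then (d : ℂ) else 0)]
    split_ifs <;> simp [sq]
  -- With `δ = δ_{p,q}` and `D` the indicator that `p` and `q` are diagonal, `(δ + D)(δ - D/d) = δ +
  -- (1 - 1/d) δD - D/d`. For `ω = 0` the sums of `δ, δD, D` are `|R(0)|, d, d²`, leaving `|R(0)| -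
  -- 1`.
  have key : coeffMoment lam (centered O) ω (secondMoment (haarU d) id)
      (secondMoment (haarU d) id) = C₁ O / ((d : ℂ) * (d + 1)) *
      ((∑ p ∈ generator lam ω, ∑ q ∈ generator lam ω, (if p = q then (1 : ℂ) else 0)) +
      (1 - 1 / d) * (∑ p ∈ generator lam ω, ∑ q ∈ generator lam ω,
        (if p = q then (if p.1 = p.2 then (1 : ℂ) else 0) else 0)) -
      (1 / d) * (∑ p ∈ generator lam ω, ∑ q ∈ generator lam ω,
        (if p.1 = p.2 then if q.1 = q.2 then (1 : ℂ) else 0 else 0))) := by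
    simp only [coeffMoment, obsMoment_centered_haar hd hO, stateMoment_haar hd, Finset.mul_sum,
      ← Finset.sum_sub_distrib, ← Finset.sum_add_distrib]
    refine Finset.sum_congr rfl fun p _ => Finset.sum_congr rfl fun q _ => ?_
    generalize (d : ℂ) * (d + 1) = D
    by_cases h1 : p = q
    · subst h1
      by_cases h2 : p.1 = p.2
      · simp [h2]; ring
      · simp [h2]; ring
    · by_cases h2 : p.1 = p.2 <;> by_cases h3 : q.1 = q.2 <;> simp [h1, h2, h3]
      ring
  rw [key, s1, s2, s3]
  by_cases h : ω = 0
  · simp only [h, if_true]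
    congr 1
    field_simp
    ring
  · simp [h]

end Haar

section Bound

variable {Ω : Type*} [MeasurableSpace Ω] {P : Measure Ω} [IsProbabilityMeasure P]
  {W₁ W₂ : Ω → U d}

lemma cvar_fourierCoeff_centered (h₁ : Measurable W₁) (h₂ : Measurable W₂)
    (hind : IndepFun W₁ W₂ P) (lam : Fin d → ℝ) (O : Matrix (Fin d) (Fin d) ℂ) (ω : ℝ) :
    cvar P (fun θ => fourierCoeff lam O ω (W₁ θ) (W₂ θ)) =
      cvar P (fun θ => fourierCoeff lam (centered O) ω (W₁ θ) (W₂ θ)) := by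
  simp only [centered, fourierCoeff_sub_smul_one]
  exact (cvar_sub_const (integrable_fourierCoeff h₁ h₂ hind lam O ω) _).symm

lemma cvar_fourierCoeff_eq (h₁ : Measurable W₁) (h₂ : Measurable W₂)
    (hind : IndepFun W₁ W₂ P) (lam : Fin d → ℝ) {O : Matrix (Fin d) (Fin d) ℂ}
    (hO : O.IsHermitian) (ω : ℝ) :
    cvar P (fun θ => fourierCoeff lam O ω (W₁ θ) (W₂ θ)) =
      (coeffMoment lam (centered O) ω (secondMoment P W₁) (secondMoment P W₂)).re -
        ‖∫ θ, fourierCoeff lam (centered O) ω (W₁ θ) (W₂ θ) ∂P‖ ^ 2 := by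
  have hO' := centered_isHermitian hO
  rw [cvar_fourierCoeff_centered h₁ h₂ hind, cvar_eq (integrable_fourierCoeff h₁ h₂ hind _ _ _)
    (integrable_norm_sq_fourierCoeff h₁ h₂ hind _ hO' _), coeffMoment,
    ← integral_norm_sq_fourierCoeff h₁ h₂ hind lam hO' ω, Complex.ofReal_re]

/-- The first moment is the second moment with one copy traced out, since columns have norm `1`. -/
lemma integral_density_haar (hd : 2 ≤ d) (p : Idx d) :
    ∫ V : U d, star ((V : Matrix (Fin d) (Fin d) ℂ) p.1 0) *
      (V : Matrix (Fin d) (Fin d) ℂ) p.2 0 ∂haarU d = (if p.1 = p.2 then 1 else 0) / d := by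
  have h1 : ∀ V : U d, star ((V : Matrix (Fin d) (Fin d) ℂ) p.1 0) *
      (V : Matrix (Fin d) (Fin d) ℂ) p.2 0 = ∑ k, stateMoment (momentMatrix (id V)) p (k, k) := by
    intro V
    simp only [id, stateMoment_momentMatrix, ← Finset.mul_sum]
    have := sum_norm_column_sq V
    simp only [mul_comm (star _)] at this
    rw [this, mul_one]
  simp only [h1]
  rw [integral_finsetSum _ fun k _ => integrable_comp measurable_id (continuous_stateMoment _ _)]
  simp only [← stateMoment_secondMoment, stateMoment_haar hd]
  rw [← Finset.sum_div, Finset.sum_add_distrib]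
  have hd0 : (d : ℂ) ≠ 0 := by exact_mod_cast NeZero.ne d
  have hd2 : (d : ℂ) + 1 ≠ 0 := by exact_mod_cast Nat.succ_ne_zero d
  have h2 : ∑ k : Fin d, (if p = (k, k) then (1 : ℂ) else 0) = if p.1 = p.2 then 1 else 0 := by
    simp only [Prod.ext_iff, ite_and, Finset.sum_ite_eq, Finset.mem_univ, if_true]
    simp [eq_comm]
  rw [h2]
  simp only [and_true]
  split_ifs
  · simp
    field_simp
  · simp

/-- The mean vanishes: averaging `W₁` leaves the maximally mixed state, and the observable is
traceless. -/
lemma varTwoDesign_eq_coeffMoment (hd : 2 ≤ d) (lam : Fin d → ℝ) {O : Matrix (Fin d) (Fin d) ℂ}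
    (hO : O.IsHermitian) (ω : ℝ) :
    varTwoDesign lam O ω = (coeffMoment lam (centered O) ω (secondMoment (haarU d) id)
      (secondMoment (haarU d) id)).re := by
  have hind : IndepFun Prod.fst Prod.snd ((haarU d).prod (haarU d)) :=
    indepFun_prod (μ := haarU d) (ν := haarU d) measurable_id measurable_id
  rw [varTwoDesign, cvar_fourierCoeff_eq measurable_fst measurable_snd hind lam hO,
    secondMoment_prod_fst, secondMoment_prod_snd]
  have h0 : ∫ θ : U d × U d, fourierCoeff lam (centered O) ω θ.1 θ.2
      ∂((haarU d).prod (haarU d)) = 0 := by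
    rw [integral_fourierCoeff measurable_fst measurable_snd hind]
    have h1 : ∀ p : Idx d, ∫ θ : U d × U d, star ((θ.1 : Matrix (Fin d) (Fin d) ℂ) p.1 0) *
        (θ.1 : Matrix (Fin d) (Fin d) ℂ) p.2 0 ∂((haarU d).prod (haarU d)) =
        (if p.1 = p.2 then 1 else 0) / d := by
      intro p
      rw [← integral_density_haar hd p]
      conv_rhs => rw [← (measurePreserving_fst (μ := haarU d) (ν := haarU d)).map_eq]
      exact (integral_map measurable_fst.aemeasurable
        (continuous_density p).measurable.aestronglyMeasurable).symm
    simp only [h1]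
    have h2 := sum_generator_diag lam ω fun p => 1 / (d : ℂ) *
      ∫ θ : U d × U d, heisenberg (centered O) θ.2 p.1 p.2 ∂((haarU d).prod (haarU d))
    have h3 : ∑ k, ∫ θ : U d × U d, heisenberg (centered O) θ.2 k k
        ∂((haarU d).prod (haarU d)) = 0 := by
      rw [← integral_finsetSum _ fun k _ =>
        integrable_comp measurable_snd (continuous_heisenberg_entry _ _ _)]
      have : ∀ V : U d, ∑ k, heisenberg (centered O) V k k = 0 := fun V =>
        (trace_heisenberg _ V).trans (trace_centered O)
      simp only [this, integral_zero]
    rw [← Finset.mul_sum, h3, mul_zero, ite_self] at h2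
    refine (Finset.sum_congr rfl fun p _ => ?_).trans h2
    split_ifs <;> simp
  rw [h0]
  simp

/-- The variance exceeds its value for a 2-design by at most three contributions: the deviation
of the first unitary, that of the second, and their product. -/
theorem cvar_fourierCoeff_le (hd : 2 ≤ d) (h₁ : Measurable W₁) (h₂ : Measurable W₂)
    (hind : IndepFun W₁ W₂ P) (lam : Fin d → ℝ) {O : Matrix (Fin d) (Fin d) ℂ}
    (hO : O.IsHermitian) (ω : ℝ) :
    cvar P (fun θ => fourierCoeff lam O ω (W₁ θ) (W₂ θ)) ≤ varTwoDesign lam O ω +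
      (C₁ O * ‖∑ p ∈ generator lam ω, stateMoment (deviation P W₁) p p‖ +
        ‖∑ p ∈ generator lam ω, obsMoment O (deviation P W₂) p p‖ / ((d : ℝ) * (d + 1)) +
        ‖coeffMoment lam (centered O) ω (deviation P W₁) (deviation P W₂)‖) := by
  have e1 : secondMoment P W₁ = secondMoment (haarU d) id - deviation P W₁ := by
    rw [deviation, sub_sub_cancel]
  have e2 : secondMoment P W₂ = secondMoment (haarU d) id - deviation P W₂ := by
    rw [deviation, sub_sub_cancel]
  rw [cvar_fourierCoeff_eq h₁ h₂ hind lam hO, varTwoDesign_eq_coeffMoment hd lam hO, e1, e2,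
    coeffMoment_sub_sub, coeffMoment_deviation_haar hd hO lam ω h₁,
    coeffMoment_haar_deviation hd O lam ω h₂]
  simp only [Complex.add_re, Complex.sub_re]
  -- The squared mean is discarded here; the remaining loss is the triangle inequality on the three
  -- deviation terms.
  have b0 := sq_nonneg ‖∫ θ, fourierCoeff lam (centered O) ω (W₁ θ) (W₂ θ) ∂P‖
  have b1 := neg_le_of_abs_le (Complex.abs_re_le_norm
    (C₁ O * ∑ p ∈ generator lam ω, stateMoment (deviation P W₁) p p))
  have b2 := neg_le_of_abs_le (Complex.abs_re_le_norm
    ((∑ p ∈ generator lam ω, obsMoment O (deviation P W₂) p p) / ((d : ℂ) * (d + 1))))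
  have b3 := Complex.re_le_norm
    (coeffMoment lam (centered O) ω (deviation P W₁) (deviation P W₂))
  rw [norm_mul, Complex.norm_real, Real.norm_of_nonneg (C₁_nonneg hd hO)] at b1
  have hn : ‖(d : ℂ) * (d + 1)‖ = (d : ℝ) * (d + 1) := by
    rw [norm_mul, Complex.norm_natCast]
    congr 1
    exact_mod_cast Complex.norm_natCast (d + 1)
  rw [norm_div, hn] at b2
  linarith

end Bound

end SecondMoment

/-! ### Bounds on the deviation terms in the three distances. -/

section Bounds

variable {d : ℕ}

/-- The reshuffling of indices relating pairs of frequencies to matrix entries of a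
superoperator. -/
def reshuffle (d : ℕ) : Idx d × Idx d ≃ Idx d × Idx d where
  toFun x := ((x.1.2, x.2.1), (x.1.1, x.2.2))
  invFun u := ((u.2.1, u.1.1), (u.1.2, u.2.2))
  left_inv _ := rfl
  right_inv _ := rfl

lemma sum_generator_reshuffle_le (lam : Fin d → ℝ) (ω : ℝ) {f : Idx d × Idx d → ℝ}
    (hf : ∀ u, 0 ≤ f u) :
    ∑ p ∈ generator lam ω, ∑ q ∈ generator lam ω, f (reshuffle d (p, q)) ≤ ∑ u, f u := by
  rw [← (reshuffle d).sum_comp f, Fintype.sum_prod_type]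
  refine (Finset.sum_le_sum fun p _ => ?_).trans
    (Finset.sum_le_univ_sum_of_nonneg fun p => Finset.sum_nonneg fun q _ => hf _)
  exact Finset.sum_le_univ_sum_of_nonneg fun q => hf _

lemma norm_sum_le_sqrt_card {σ : Type*} (s : Finset σ) (f : σ → ℂ) :
    ‖∑ p ∈ s, f p‖ ≤ √(s.card : ℝ) * √(∑ p ∈ s, ‖f p‖ ^ 2) := by
  have h := Real.sum_mul_le_sqrt_mul_sqrt s (fun _ => 1) (fun p => ‖f p‖)
  simp only [one_mul, one_pow, Finset.sum_const, nsmul_eq_mul, mul_one] at h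
  exact (norm_sum_le _ _).trans h

/-- Diagonal sums are controlled by the Hilbert-Schmidt norm. -/
lemma norm_sum_diag_le {σ : Type*} (s : Finset σ) (f : σ → σ → ℂ) {a : ℝ} (ha : 0 ≤ a)
    (h : ∑ p ∈ s, ∑ q ∈ s, ‖f p q‖ ^ 2 ≤ a ^ 2) : ‖∑ p ∈ s, f p p‖ ≤ √(s.card : ℝ) * a := by
  refine (norm_sum_le_sqrt_card s _).trans (mul_le_mul_of_nonneg_left ?_ (Real.sqrt_nonneg _))
  refine Real.sqrt_le_iff.2 ⟨ha, (Finset.sum_le_sum fun p hp => ?_).trans h⟩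
  exact Finset.single_le_sum (f := fun q => ‖f p q‖ ^ 2) (fun q _ => sq_nonneg _) hp

lemma norm_sum_sum_mul_le {σ : Type*} (s : Finset σ) (f g : σ → σ → ℂ) {a b : ℝ} (ha : 0 ≤ a)
    (hb : 0 ≤ b) (hf : ∑ p ∈ s, ∑ q ∈ s, ‖f p q‖ ^ 2 ≤ a ^ 2)
    (hg : ∑ p ∈ s, ∑ q ∈ s, ‖g p q‖ ^ 2 ≤ b ^ 2) :
    ‖∑ p ∈ s, ∑ q ∈ s, f p q * g p q‖ ≤ a * b := by
  rw [← Finset.sum_product'] at hf hg ⊢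
  have h := Real.sum_mul_le_sqrt_mul_sqrt (s ×ˢ s) (fun x => ‖f x.1 x.2‖) (fun x => ‖g x.1 x.2‖)
  refine (norm_sum_le _ _).trans ?_
  simp only [norm_mul]
  refine h.trans (mul_le_mul (Real.sqrt_le_iff.2 ⟨ha, hf⟩) (Real.sqrt_le_iff.2 ⟨hb, hg⟩)
    (Real.sqrt_nonneg _) ha)

lemma sum_norm_sq_kronecker (O : Matrix (Fin d) (Fin d) ℂ) :
    ∑ u : Idx d × Idx d, ‖(O ⊗ₖ O) u.2 u.1‖ ^ 2 = (∑ i, ∑ j, ‖O i j‖ ^ 2) ^ 2 := by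
  rw [Fintype.sum_prod_type_right, sq (∑ i, ∑ j, ‖O i j‖ ^ 2), ← Fintype.sum_prod_type']
  simp only [Fintype.sum_prod_type, Matrix.kroneckerMap_apply, norm_mul, mul_pow, Finset.sum_mul]
  refine Finset.sum_congr rfl fun i _ => ?_
  rw [Finset.sum_comm]
  simp only [Finset.mul_sum]

section HilbertSchmidt

variable (lam : Fin d → ℝ) (ω : ℝ) {A : Matrix (Idx d × Idx d) (Idx d × Idx d) ℂ} {ε : ℝ}

/-- State moments are, up to `reshuffle`, distinct entries of one column of `A`. -/
lemma BilinBound.sum_norm_sq_stateMoment_le [NeZero d] (hA : BilinBound A ε) (hε : 0 ≤ ε) :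
    ∑ p ∈ generator lam ω, ∑ q ∈ generator lam ω, ‖stateMoment A p q‖ ^ 2 ≤ ε ^ 2 := by
  have h1 := hA.mulVec hε (Pi.single ((0, 0), (0, 0)) 1)
  rw [l2norm_single, mul_one] at h1
  have h2 := pow_le_pow_left₀ (l2norm_nonneg _) h1 2
  rw [l2norm_sq] at h2
  simp only [Matrix.mulVec_single_one] at h2
  exact (sum_generator_reshuffle_le lam ω
    (f := fun u => ‖A u ((0, 0), (0, 0))‖ ^ 2) fun _ => sq_nonneg _).trans h2

/-- Observable moments are distinct entries of the transpose of `A` applied to the vectorized `O ⊗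
O`, whose Euclidean norm is `‖O‖₂²`. -/
lemma BilinBound.sum_norm_sq_obsMoment_le (hA : BilinBound A ε) (hε : 0 ≤ ε)
    (O : Matrix (Fin d) (Fin d) ℂ) :
    ∑ p ∈ generator lam ω, ∑ q ∈ generator lam ω, ‖obsMoment O A p q‖ ^ 2 ≤
      (ε * ∑ i, ∑ j, ‖O i j‖ ^ 2) ^ 2 := by
  set v : Idx d × Idx d → ℂ := fun u => (O ⊗ₖ O) u.2 u.1
  have hv : l2norm v = ∑ i, ∑ j, ‖O i j‖ ^ 2 := by
    rw [l2norm, sum_norm_sq_kronecker, Real.sqrt_sq]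
    exact Finset.sum_nonneg fun _ _ => Finset.sum_nonneg fun _ _ => sq_nonneg _
  have h1 := hA.transpose.mulVec hε v
  rw [hv] at h1
  have h2 := pow_le_pow_left₀ (l2norm_nonneg _) h1 2
  rw [l2norm_sq] at h2
  refine le_trans ?_ ((sum_generator_reshuffle_le lam ω
    (f := fun u => ‖A.transpose.mulVec v u‖ ^ 2) fun _ => sq_nonneg _).trans h2)
  refine le_of_eq (Finset.sum_congr rfl fun p _ => Finset.sum_congr rfl fun q _ => ?_)
  congr 2
  simp only [obsMoment, Matrix.mulVec, dotProduct, Matrix.transpose_apply, v]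
  exact Finset.sum_congr rfl fun u _ => mul_comm _ _

end HilbertSchmidt

section Entrywise

variable {A : Matrix (Idx d × Idx d) (Idx d × Idx d) ℂ} {η : ℝ}

lemma norm_obsMoment_le (hA : ∀ a b, ‖A a b‖ ≤ η) (O : Matrix (Fin d) (Fin d) ℂ) (p q : Idx d) :
    ‖obsMoment O A p q‖ ≤ (∑ k, ∑ l, ‖(O ⊗ₖ O) k l‖) * η := by
  rw [obsMoment]
  refine (norm_sum_le _ _).trans ?_
  rw [Fintype.sum_prod_type_right, Finset.sum_mul]
  refine Finset.sum_le_sum fun k _ => ?_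
  rw [Finset.sum_mul]
  refine Finset.sum_le_sum fun l _ => ?_
  rw [norm_mul]
  exact mul_le_mul_of_nonneg_left (hA _ _) (norm_nonneg _)

lemma norm_sum_le_card_mul {σ : Type*} (s : Finset σ) (f : σ → ℂ) {c : ℝ}
    (h : ∀ p, ‖f p‖ ≤ c) : ‖∑ p ∈ s, f p‖ ≤ s.card * c := by
  refine (norm_sum_le _ _).trans ((Finset.sum_le_sum fun p _ => h p).trans (le_of_eq ?_))
  simp

lemma sum_norm_sq_le_card_mul {σ : Type*} (s : Finset σ) (f : σ → σ → ℂ) {c : ℝ}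
    (h : ∀ p q, ‖f p q‖ ≤ c) :
    ∑ p ∈ s, ∑ q ∈ s, ‖f p q‖ ^ 2 ≤ (s.card * c) ^ 2 := by
  refine (Finset.sum_le_sum fun p _ => Finset.sum_le_sum fun q _ =>
    pow_le_pow_left₀ (norm_nonneg _) (h p q) 2).trans (le_of_eq ?_)
  simp
  ring

end Entrywise

section Diamond

variable (lam : Fin d → ℝ) (ω : ℝ) {A : Matrix (Idx d × Idx d) (Idx d × Idx d) ℂ} {ε : ℝ}

/-- This truncated swap is the test operator that extracts the diagonal state moments over `R(ω)`.
Being a partial permutation it has norm at most `1`, so no factor `|R(ω)|` enters the `C₁ ε` term.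
-/
lemma bilinBound_swap_generator :
    BilinBound (Matrix.of fun s r : Idx d => if s ∈ generator lam ω then
      (if r = s.swap then (1 : ℂ) else 0) else 0) 1 := by
  refine BilinBound.of_mulVec fun x => ?_
  rw [one_mul]
  refine l2norm_le_of_sq_le (l2norm_nonneg _) ?_
  rw [l2norm_sq, ← (Equiv.prodComm (Fin d) (Fin d)).sum_comp fun i => ‖x i‖ ^ 2]
  refine Finset.sum_le_sum fun s _ => ?_
  have : (Matrix.of fun s r : Idx d => if s ∈ generator lam ω then
      (if r = s.swap then (1 : ℂ) else 0) else 0).mulVec x s =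
      if s ∈ generator lam ω then x s.swap else 0 := by
    simp only [Matrix.mulVec, dotProduct, Matrix.of_apply]
    split_ifs
    · simp
    · simp
  rw [this]
  split_ifs
  · exact le_rfl
  · simp

lemma sum_single_mul_single {ι : Type*} [Fintype ι] [DecidableEq ι] (f : ι × ι → ℂ) (r s : ι) :
    ∑ p : ι × ι, f p * ((Pi.single r 1 : ι → ℂ) p.1 * (Pi.single s 1 : ι → ℂ) p.2) = f (r, s) := by
  simp [Fintype.sum_prod_type, Pi.single_apply]

/-- The observable moments as a matrix, i.e. the adjoint superoperator applied to `O ⊗ O`. -/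
noncomputable def obsMatrix (O : Matrix (Fin d) (Fin d) ℂ)
    (A : Matrix (Idx d × Idx d) (Idx d × Idx d) ℂ) : Matrix (Idx d) (Idx d) ℂ :=
  Matrix.of fun s r => ∑ u : Idx d × Idx d, (O ⊗ₖ O) u.2 u.1 * A u (r, s)

/-- By duality, a bound from trace norm to trace norm bounds the adjoint superoperator in operator
norm. -/
lemma bilinBound_obsMatrix (hA : diamondNorm A ≤ ENNReal.ofReal ε) (hε : 0 ≤ ε)
    {O : Matrix (Fin d) (Fin d) ℂ} {c : ℝ} (hO : BilinBound O c) (hc : 0 ≤ c) :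
    BilinBound (obsMatrix O A) (c * c * ε) := by
  intro y x
  have h := norm_sum_le_of_diamondNorm_le hA hε (hO.kronecker hO hc hc) (mul_nonneg hc hc) x y
  refine le_trans (le_of_eq ?_) h
  congr 1
  rw [← Fintype.sum_prod_type_right' (f := fun r s => (O ⊗ₖ O) s r *
    ∑ p : Idx d × Idx d, A (r, s) p * (x p.1 * y p.2))]
  rw [← Fintype.sum_prod_type_right' (f := fun r s => y s * obsMatrix O A s r * x r)]
  simp only [obsMatrix, Matrix.of_apply, Finset.mul_sum, Finset.sum_mul]
  rw [Finset.sum_comm]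
  refine Finset.sum_congr rfl fun u _ => Finset.sum_congr rfl fun p _ => ?_
  ring

lemma norm_sum_stateMoment_le_of_diamondNorm [NeZero d] (hA : diamondNorm A ≤ ENNReal.ofReal ε)
    (hε : 0 ≤ ε) : ‖∑ p ∈ generator lam ω, stateMoment A p p‖ ≤ ε := by
  have h := norm_sum_le_of_diamondNorm_le hA hε (bilinBound_swap_generator lam ω) zero_le_one
    (Pi.single (0, 0) 1) (Pi.single (0, 0) 1)
  simp only [sum_single_mul_single (fun p => A (_, _) p), l2norm_single, mul_one, one_mul] at h
  refine le_trans (le_of_eq ?_) h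
  congr 1
  have hs : ∀ s : Idx d, ∑ r, (Matrix.of fun s r : Idx d => if s ∈ generator lam ω then
      (if r = s.swap then (1 : ℂ) else 0) else 0) s r * A (r, s) ((0, 0), (0, 0)) =
      if s ∈ generator lam ω then stateMoment A s s else 0 := by
    intro s
    simp only [Matrix.of_apply]
    split_ifs
    · simp only [ite_mul, one_mul, zero_mul, Finset.sum_ite_eq', Finset.mem_univ, if_true]
      rfl
    · simp
  simp only [hs, Finset.sum_ite_mem, Finset.univ_inter]

lemma norm_obsMoment_le_of_diamondNorm (hA : diamondNorm A ≤ ENNReal.ofReal ε)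
    (hε : 0 ≤ ε) {O : Matrix (Fin d) (Fin d) ℂ} {c : ℝ} (hO : BilinBound O c) (hc : 0 ≤ c)
    (p q : Idx d) : ‖obsMoment O A p q‖ ≤ c ^ 2 * ε := by
  have h := bilinBound_obsMatrix hA hε hO hc (Pi.single (p.1, q.2) 1) (Pi.single (p.2, q.1) 1)
  rw [l2norm_single, l2norm_single, mul_one, mul_one, ← sq] at h
  refine le_trans (le_of_eq ?_) h
  congr 1
  simp [Pi.single_apply, obsMatrix, obsMoment]

lemma norm_coeffMoment_le_of_diamondNorm [NeZero d]
    {A' : Matrix (Idx d × Idx d) (Idx d × Idx d) ℂ} (hA : diamondNorm A ≤ ENNReal.ofReal ε)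
    (hA' : diamondNorm A' ≤ ENNReal.ofReal ε)
    (hε : 0 ≤ ε) {O : Matrix (Fin d) (Fin d) ℂ} {c : ℝ} (hO : BilinBound O c) (hc : 0 ≤ c) :
    ‖coeffMoment lam O ω A A'‖ ≤ c ^ 2 * ε ^ 2 := by
  -- With row `s = (p.1, q.2)` and column `r = (p.2, q.1)`, the conditions `p, q ∈ R(ω)` say exactly
  -- that these two labels agree. The restriction is thus free, and no `|R(ω)|` appears.
  have hB := (bilinBound_obsMatrix hA' hε hO hc).mask (mul_nonneg (mul_nonneg hc hc) hε)
    (fun s : Idx d => (lam s.1, lam s.2)) (fun r : Idx d => (lam r.1 + ω, lam r.2 - ω))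
  have h := norm_sum_le_of_diamondNorm_le hA hε hB (mul_nonneg (mul_nonneg hc hc) hε)
    (Pi.single (0, 0) 1) (Pi.single (0, 0) 1)
  simp only [sum_single_mul_single (fun p => A (_, _) p), l2norm_single, mul_one] at h
  refine le_trans (le_of_eq ?_) (h.trans (le_of_eq (by ring)))
  congr 1
  rw [coeffMoment, generator]
  simp only [Finset.sum_filter]
  rw [← Fintype.sum_prod_type_right' (f := fun r s : Idx d =>
    (Matrix.of fun s r => if (lam s.1, lam s.2) = (lam r.1 + ω, lam r.2 - ω) then
      obsMatrix O A' s r else 0) s r * A (r, s) ((0, 0), (0, 0))),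
    ← (reshuffle d).sum_comp]
  refine Eq.trans (Finset.sum_congr rfl fun p _ => ?_) (Fintype.sum_prod_type _).symm
  have hcond : ∀ q : Idx d, ((lam p.1, lam q.2) = (lam p.2 + ω, lam q.1 - ω)) ↔
      (lam p.1 - lam p.2 = ω ∧ lam q.1 - lam q.2 = ω) := by
    intro q
    rw [Prod.mk.injEq]
    constructor
    · rintro ⟨h1, h2⟩; constructor <;> linarith
    · rintro ⟨h1, h2⟩; constructor <;> linarith
  simp only [reshuffle, Equiv.coe_fn_mk, Matrix.of_apply, hcond]
  by_cases hp : lam p.1 - lam p.2 = ω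
  · simp only [hp, if_true, true_and]
    refine Finset.sum_congr rfl fun q _ => ?_
    split_ifs
    · rw [mul_comm]; rfl
    · simp
  · simp [hp]

end Diamond

end Bounds

end FourierModel

/-! ### Assembly of the variance formula and the three bounds. -/

open FourierModel in
theorem theorem2 (n : ℕ) (hn : 1 ≤ n)
    {Θ : Type*} [MeasurableSpace Θ] (P : MeasureTheory.Measure Θ)
    [MeasureTheory.IsProbabilityMeasure P]
    (W : Fin 2 → Θ → FourierModel.U (2 ^ n)) (hW : ∀ l, Measurable (W l))
    (hindep : ProbabilityTheory.IndepFun (W 0) (W 1) P)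
    (lam : Fin (2 ^ n) → ℝ)
    (O : Matrix (Fin (2 ^ n)) (Fin (2 ^ n)) ℂ) (hO : O.IsHermitian)
    (d : ℝ) (hd : d = 2 ^ n)
    (ω : ℝ) (hω : ω ∈ FourierModel.spectrum lam)
    (r : ℝ) (hr : r = (FourierModel.generator lam ω).card)
    (ε : ℝ) (hε : 0 ≤ ε) :
    FourierModel.varTwoDesign lam O ω =
        FourierModel.C₁ O / (d * (d + 1)) * (r - if ω = 0 then 1 else 0) ∧
    ((∀ l, FourierModel.IsApproxTwoDesignDiamond P (W l) ε) →
      FourierModel.cvar P (fun θ => FourierModel.fourierCoeff lam O ω (W 0 θ) (W 1 θ)) ≤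
        FourierModel.varTwoDesign lam O ω +
          (FourierModel.C₁ O * ε + FourierModel.schattenNorm 1 O ^ 2 * ε ^ 2 +
            FourierModel.spectralNorm O ^ 2 / (d * (d + 1)) * r * ε)) ∧
    ((∀ l, FourierModel.IsApproxTwoDesignMonomial P (W l) ε) →
      FourierModel.cvar P (fun θ => FourierModel.fourierCoeff lam O ω (W 0 θ) (W 1 θ)) ≤
        FourierModel.varTwoDesign lam O ω +
          ((FourierModel.C₁ O / d ^ 2 + FourierModel.C₂ O / (d * (d + 1))) * ε * r +
            FourierModel.C₂ O / d ^ 2 * (ε * r) ^ 2)) ∧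
    ((∀ l, FourierModel.IsApproxTwoDesignSpectral P (W l) ε) →
      FourierModel.cvar P (fun θ => FourierModel.fourierCoeff lam O ω (W 0 θ) (W 1 θ)) ≤
        FourierModel.varTwoDesign lam O ω +
          ((FourierModel.C₁ O + FourierModel.schattenNorm 2 O ^ 2 / (d * (d + 1))) * ε * √r +
            FourierModel.schattenNorm 2 O ^ 2 * ε ^ 2 * r)) := by
  have h2n : 2 ≤ 2 ^ n := by
    calc 2 = 2 ^ 1 := rfl
      _ ≤ 2 ^ n := Nat.pow_le_pow_right (by norm_num) hn
  have hdn : ((2 ^ n : ℕ) : ℝ) = d := by rw [hd]; push_cast; rfl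
  have hd2 : 2 ≤ d := by rw [← hdn]; exact_mod_cast h2n
  have hD : 0 < d * (d + 1) := by nlinarith
  have hr1 : 1 ≤ r := by
    rw [hr]
    obtain ⟨p, -, hp⟩ := Finset.mem_image.1 hω
    exact_mod_cast Finset.card_pos.2 ⟨p, Finset.mem_filter.2 ⟨Finset.mem_univ _, hp⟩⟩
  have hC1 := C₁_nonneg h2n hO
  have hle := cvar_fourierCoeff_le h2n (hW 0) (hW 1) hindep lam hO ω
  have hcs := sum_norm_sq_obsMoment_centered_le (P := P) (hW 1) O lam ω
  rw [hdn] at hle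
  set S₁ := ‖∑ p ∈ generator lam ω, stateMoment (deviation P (W 0)) p p‖
  set S₂ := ‖∑ p ∈ generator lam ω, obsMoment O (deviation P (W 1)) p p‖
  set S₃ := ‖coeffMoment lam (centered O) ω (deviation P (W 0)) (deviation P (W 1))‖
  refine ⟨?_, fun h => ?_, fun h => ?_, fun h => ?_⟩
  · rw [varTwoDesign_eq_coeffMoment h2n lam hO, coeffMoment_haar_haar h2n hO, ← hdn, hr]
    rw [← Complex.ofReal_re (C₁ O / (((2 ^ n : ℕ) : ℝ) * (((2 ^ n : ℕ) : ℝ) + 1)) *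
      (((generator lam ω).card : ℝ) - if ω = 0 then 1 else 0))]
    congr 1
    split_ifs <;> push_cast <;> rfl
  · have b1 : S₁ ≤ ε := norm_sum_stateMoment_le_of_diamondNorm lam ω (h 0) hε
    have b2 : S₂ ≤ r * (spectralNorm O ^ 2 * ε) := by
      rw [hr]
      exact norm_sum_le_card_mul _ _ fun p => norm_obsMoment_le_of_diamondNorm (h 1) hε
        (bilinBound_spectralNorm O) (spectralNorm_nonneg O) p p
    -- Centering may increase the operator norm of `O`, but not its Hilbert-Schmidt norm, which is
    -- at most `‖O‖₁`.
    have b3 : S₃ ≤ schattenNorm 1 O ^ 2 * ε ^ 2 := by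
      refine (norm_coeffMoment_le_of_diamondNorm lam ω (h 0) (h 1) hε
        (bilinBound_hilbertSchmidt (centered O)) (Real.sqrt_nonneg _)).trans ?_
      rw [Real.sq_sqrt (Finset.sum_nonneg fun _ _ => Finset.sum_nonneg fun _ _ => sq_nonneg _)]
      exact mul_le_mul_of_nonneg_right ((sum_norm_sq_centered_le hO).trans
        (sum_sq_le_schattenNorm_one_sq O)) (sq_nonneg _)
    have b1' := mul_le_mul_of_nonneg_left b1 hC1
    have b2' := div_le_div_of_nonneg_right b2 hD.le
    have e2 : r * (spectralNorm O ^ 2 * ε) / (d * (d + 1)) =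
        spectralNorm O ^ 2 / (d * (d + 1)) * r * ε := by ring
    rw [e2] at b2'
    linarith
  · have hC2 : ∑ k, ∑ l, ‖(O ⊗ₖ O) k l‖ = C₂ O * d ^ 2 := by
      have : d ^ 2 ≠ 0 := by positivity
      rw [C₂, hdn]
      simp only [← Finset.sum_div]
      rw [div_mul_cancel₀ _ this]
    have hC2n : 0 ≤ C₂ O := Finset.sum_nonneg fun _ _ => Finset.sum_nonneg fun _ _ => by positivity
    have h' : ∀ l a b, ‖deviation P (W l) a b‖ ≤ ε / d ^ 2 := by
      intro l a b
      have := h l a b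
      rwa [hdn] at this
    have eC : C₂ O * d ^ 2 * (ε / d ^ 2) = C₂ O * ε := by
      have : d ≠ 0 := by positivity
      field_simp
    have hob : ∀ p q, ‖obsMoment O (deviation P (W 1)) p q‖ ≤ C₂ O * ε := by
      intro p q
      have := norm_obsMoment_le (h' 1) O p q
      rwa [hC2, eC] at this
    have b1 : S₁ ≤ r * (ε / d ^ 2) := by
      rw [hr]
      exact norm_sum_le_card_mul _ _ fun p => h' 0 _ _
    have b2 : S₂ ≤ r * (C₂ O * ε) := by
      rw [hr]
      exact norm_sum_le_card_mul _ _ fun p => hob p p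
    -- `S₃` involves the centered observable, and centering contracts the Hilbert-Schmidt norm
    -- rather than each entry. Hence the entrywise bounds are first summed over the `r × r` pairs.
    have b3 : S₃ ≤ (r * (ε / d ^ 2)) * (r * (C₂ O * ε)) := by
      refine norm_sum_sum_mul_le _ _ _ (by positivity) (by positivity) ?_ (hcs.trans ?_)
      · rw [hr]
        exact sum_norm_sq_le_card_mul _ _ fun p q => h' 0 _ _
      · rw [hr]
        exact sum_norm_sq_le_card_mul _ _ hob
    have b1' := mul_le_mul_of_nonneg_left b1 hC1
    have b2' := div_le_div_of_nonneg_right b2 hD.le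
    have e : C₁ O * (r * (ε / d ^ 2)) + r * (C₂ O * ε) / (d * (d + 1)) +
        r * (ε / d ^ 2) * (r * (C₂ O * ε)) =
        (C₁ O / d ^ 2 + C₂ O / (d * (d + 1))) * ε * r + C₂ O / d ^ 2 * (ε * r) ^ 2 := by ring
    linarith
  · have hA : ∀ l, BilinBound (deviation P (W l)) ε := fun l =>
      (bilinBound_spectralNorm _).mono (h l)
    rw [schattenNorm_two_sq]
    set s := ∑ i, ∑ j, ‖O i j‖ ^ 2
    have hs : 0 ≤ s := Finset.sum_nonneg fun _ _ => Finset.sum_nonneg fun _ _ => sq_nonneg _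
    have k1 := (hA 0).sum_norm_sq_stateMoment_le lam ω hε
    have k2 := (hA 1).sum_norm_sq_obsMoment_le lam ω hε O
    have b1 : S₁ ≤ √r * ε := by
      rw [hr]
      exact norm_sum_diag_le _ _ hε k1
    have b2 : S₂ ≤ √r * (ε * s) := by
      rw [hr]
      exact norm_sum_diag_le _ _ (mul_nonneg hε hs) k2
    have b3 : S₃ ≤ ε * (ε * s) :=
      norm_sum_sum_mul_le _ _ _ hε (mul_nonneg hε hs) k1 (hcs.trans k2)
    -- The argument gives the product term without `r`; `ω ∈ Ω` makes `r ≥ 1`, which yields the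
    -- stated form.
    have b3' : ε * (ε * s) ≤ s * ε ^ 2 * r := by
      have := mul_le_mul_of_nonneg_left hr1 (mul_nonneg hs (sq_nonneg ε))
      linarith
    have b1' := mul_le_mul_of_nonneg_left b1 hC1
    have b2' := div_le_div_of_nonneg_right b2 hD.le
    have e : C₁ O * (√r * ε) + √r * (ε * s) / (d * (d + 1)) =
        (C₁ O + s / (d * (d + 1))) * ε * √r := by ring
    linarith
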